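/- Let $\hat\theta = i(\bar\partial-\partial)(|z_1|^2+|z_2|^2)$ be the standard contact form on the unit sphere $S^3\subset\mathbb{C}^2$, let $\hat\xi=\ker\hat\theta\subset TS^3$, and let $\hat J$ be the standard (spherical) CR structure on $\hat\xi$, i.e. multiplication by $i$. A CR structure on $\hat\xi$ is a smooth bundle endomorphism $J:\hat\xi\to\hat\xi$ with $J^2=-1$, and here $d\hat\theta(X,JX)>0$ for $0\ne X\in\hat\xi$. For a contact form $\theta=e^{2f}\hat\theta$, $f\in C^\infty(S^3,\mathbb{R})$, let $T$ be its Reeb field, $Z_1$ a frame with $JZ_1=iZ_1$, $Z_{\bar 1}=\overline{Z_1}$, and dual coframe $(\theta,\theta^1,\theta^{\bar 1})$, normalized by $d\theta=i\,\theta^1\wedge\theta^{\bar1}$. Let $\omega_1^1$ and $A^1_{\bar 1}$ be the connection form and torsion determined by $d\theta^1=\theta^1\wedge\omega_1^1+A^1_{\bar 1}\,\theta\wedge\theta^{\bar1}$, $\omega_1^1+\omega_{\bar1}^{\bar1}=0$, where $\omega_{\bar1}^{\bar1}=\overline{\omega_1^1}$, and let $A_{11}=\overline{A^1_{\bar1}}$.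 The CR Paneitz operator is $$P_{J,\theta}\varphi = 4\left(\varphi_{,\bar 1 1 1}+iA_{11}\varphi_{,\bar1}\right)_{,\bar1},$$ with covariant derivatives $c_{,1}=Z_1c-k\,\omega_1^1(Z_1)c$, $c_{,\bar1}=Z_{\bar1}c-k\,\omega_1^1(Z_{\bar1})c$, where $k$ is the number of lower indices $1$ minus the number of lower indices $\bar1$ of $c$. It is called non-negative if $\int_{S^3}\varphi\,P_{J,\theta}\varphi\;\theta\wedge d\theta\ge 0$ for all real-valued $\varphi\in C^\infty(S^3)$. **Proposition 4.1.** There exist CR structures on $S^3$ arbitrarily close to the spherical one for which the CR Paneitz operator is not non-negative. Precisely: for every $k\in\mathbb{N}$ and $\varepsilon>0$ there is a smooth CR structure $J$ on $\hat\xi$, with $d\hat\theta(X,JX)>0$ for $0\neq X\in\hat\xi$, which is $\varepsilon$-close to $\hat J$ in $C^k(S^3)$, such that for every $f\in C^\infty(S^3,\mathbb{R})$ the operator $P_{J,e^{2f}\hat\theta}$ is not non-negative. Here $J$ is $\varepsilon$-close to $\hat J$ in $C^k(S^3)$ if, extending $J_p$ and $\hat J_p$ by zero on the orthogonal complement of $\hat\xi_p$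 in $\mathbb{R}^4=\mathbb{C}^2$ and extending the entries of the $4\times4$ matrix $J-\hat J$ to $\mathbb{R}^4\setminus\{0\}$ as constants along rays, all derivatives of these entries of order at most $k$ have norm less than $\varepsilon$ at all points of $S^3$. -/

import Mathlib

open scoped Manifold ContDiff Matrix

noncomputable section

namespace CRSphere

/-- `ℝ⁴ = ℂ²`, with coordinates `(x₁, y₁, x₂, y₂)` and `z₁ = x₁ + i y₁`, `z₂ = x₂ + i y₂`. -/
abbrev R4 : Type := EuclideanSpace ℝ (Fin 4)

/-- The unit sphere of `ℂ²`, with Mathlib's structure of a smooth manifold. -/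
abbrev S3 : Type := Metric.sphere (0 : R4) 1

/-- A `C^∞` map from `S³` to a real normed space. -/
abbrev Smooth {F : Type*} [NormedAddCommGroup F] [NormedSpace ℝ F] (f : S3 → F) : Prop :=
  ContMDiff (𝓡 3) 𝓘(ℝ, F) ∞ f

/-! ### Calculus on the sphere

Tangent vectors of `S³` at `p` are vectors of `ℝ⁴` orthogonal to `p`; complexified tangent vectors
are vectors of `ℂ⁴ = ℂ ⊗ ℝ⁴`. A `1`-form is given by its coefficients with respect to
`dx₁, dy₁, dx₂, dy₂`, and only its values on tangent vectors matter. -/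

/-- The extension of `f : S³ → F` which is constant along rays. -/
def rayExt {F : Type*} [Zero F] (f : S3 → F) (x : R4) : F :=
  if h : x = 0 then 0 else f ⟨‖x‖⁻¹ • x, by simp [norm_smul, h]⟩

/-- The derivative at `p` of the extension of `f` in the direction of the `i`-th coordinate. -/
def partialD {F : Type*} [NormedAddCommGroup F] [NormedSpace ℝ F]
    (f : S3 → F) (i : Fin 4) (p : S3) : F :=
  fderiv ℝ (rayExt f) (p : R4) (EuclideanSpace.single i 1)

/-- The derivative `V f` of a function `f` along a complex tangent vector field `V`. -/
def lieD (V : S3 → Fin 4 → ℂ) (f : S3 → ℂ) (p : S3) : ℂ :=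
  ∑ i, V p i * partialD f i p

/-- The exterior derivative `(dα)_p (V, W)` of the `1`-form `α = ∑ αⱼ dxⱼ`. -/
def dForm {𝕜 : Type*} [NormedField 𝕜] [NormedAlgebra ℝ 𝕜]
    (α : S3 → Fin 4 → 𝕜) (p : S3) (V W : Fin 4 → 𝕜) : 𝕜 :=
  ∑ i, ∑ j, partialD (fun q => α q j) i p * (V i * W j - W i * V j)

/-- The position vector of a point, as a tuple of coordinates. -/
def pos (p : S3) : Fin 4 → ℝ := fun i => (p : R4) i

/-- Real vectors (and covectors) regarded as complex ones. -/
def cplx (v : Fin 4 → ℝ) : Fin 4 → ℂ := fun i => (v i : ℂ)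

/-- The complex conjugate of a vector or covector. -/
def bar (v : Fin 4 → ℂ) : Fin 4 → ℂ := fun i => (starRingEnd ℂ) (v i)

/-- `V` is tangent to `S³` at `p`. -/
def Tangent (p : S3) (V : Fin 4 → ℝ) : Prop := pos p ⬝ᵥ V = 0

/-- `V` is a complexified tangent vector of `S³` at `p`. -/
def CTangent (p : S3) (V : Fin 4 → ℂ) : Prop := cplx (pos p) ⬝ᵥ V = 0

/-- The `3`-form `θ ∧ dθ` on `S³`, as a density with respect to the surface measure. With
`ν = ∑ xᵢ dxᵢ` the dual of the outward normal, it is the coefficient of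
`dx₁ ∧ dy₁ ∧ dx₂ ∧ dy₂` in `ν ∧ θ ∧ dθ`. -/
def contactDensity (θ : S3 → Fin 4 → ℝ) (p : S3) : ℝ :=
  ∑ σ : Equiv.Perm (Fin 4), ((Equiv.Perm.sign σ : ℤ) : ℝ) *
    (pos p (σ 0) * θ p (σ 1) * partialD (fun q => θ q (σ 3)) (σ 2) p)

/-- The integral `∫_{S³} h θ ∧ dθ`. -/
def contactIntegral (θ : S3 → Fin 4 → ℝ) (h : S3 → ℂ) : ℂ :=
  ∫ p, h p * (contactDensity θ p : ℂ) ∂((MeasureTheory.volume : MeasureTheory.Measure R4).toSphere)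

/-! ### Contact forms and CR structures -/

/-- The standard contact form `i (∂̄ - ∂)(|z₁|² + |z₂|²) = 2 ∑ (xₖ dyₖ - yₖ dxₖ)`. -/
def stdContact (p : S3) : Fin 4 → ℝ := ![-2 * pos p 1, 2 * pos p 0, -2 * pos p 3, 2 * pos p 2]

/-- The contact form `e^{2f} θ₀`, where `θ₀` is the standard one. -/
def conformalContact (f : S3 → ℝ) (p : S3) : Fin 4 → ℝ := Real.exp (2 * f p) • stdContact p

/-- `X` lies in the standard contact plane at `p`, the kernel of the standard contact form in the
tangent space of `S³` at `p`. -/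
def InContact (p : S3) (X : Fin 4 → ℝ) : Prop := Tangent p X ∧ stdContact p ⬝ᵥ X = 0

/-- A smooth CR structure `J : ξ → ξ`, `J² = -1`, on the standard contact bundle `ξ` of `S³`, whose
Levi form is positive for the standard contact form. Each `J_p` is recorded as the matrix
which is `J_p` on `ξ_p` and zero on the orthogonal complement of `ξ_p` in `ℝ⁴`. -/
structure CRStructure where
  J : S3 → Matrix (Fin 4) (Fin 4) ℝ
  smooth : ∀ a b, Smooth (fun p => J p a b)
  maps : ∀ p X, InContact p X → InContact p (J p *ᵥ X)
  sq : ∀ p X, InContact p X → J p *ᵥ (J p *ᵥ X) = -X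
  levi_pos : ∀ p X, InContact p X → X ≠ 0 → 0 < dForm stdContact p X (J p *ᵥ X)
  normal : ∀ p, J p *ᵥ pos p = 0
  conormal : ∀ p, J p *ᵥ stdContact p = 0

/-- The matrix of multiplication by `i` on `ℂ² = ℝ⁴`. -/
def mulI : Matrix (Fin 4) (Fin 4) ℝ := !![0, -1, 0, 0; 1, 0, 0, 0; 0, 0, 0, -1; 0, 0, 1, 0]

/-- The standard (spherical) CR structure as a matrix: multiplication by `i` on the contact plane
(composed with the orthogonal projection onto the contact plane). -/
def stdJ (p : S3) : Matrix (Fin 4) (Fin 4) ℝ :=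
  mulI * (1 - Matrix.vecMulVec (pos p) (pos p)
    - Matrix.vecMulVec (mulI *ᵥ pos p) (mulI *ᵥ pos p))

theorem pos_norm (p : S3) : pos p 0^2+pos p 1^2+pos p 2^2+pos p 3^2 = 1 := by
  have h : ‖(p:R4)‖ = 1 := by simp
  have := EuclideanSpace.real_norm_sq_eq (p:R4)
  rw [h] at this
  simp [Fin.sum_univ_four] at this
  simp [pos]; linarith

/-- The derivative of the restriction to `S³` of a function on `ℝ⁴` is its tangential derivative. -/
theorem partialD_restrict {F : Type*} [NormedAddCommGroup F] [NormedSpace ℝ F] (p : S3)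
    (g : R4 → F) (L : R4 →L[ℝ] F) (hg : HasFDerivAt g L (p : R4)) (i : Fin 4) :
    partialD (fun q : S3 => g q) i p = L (EuclideanSpace.single i 1 - (pos p i) • (p:R4)) := by
  have hn : ‖(p:R4)‖ = 1 := by simp
  have hp : (p:R4) ≠ 0 := by intro h; simp [h] at hn
  have h1 : rayExt (fun q : S3 => g q) =ᶠ[nhds (p:R4)] fun x => g (‖x‖⁻¹ • x) := by
    filter_upwards [isOpen_ne.mem_nhds hp] with x hx
    simp at hx
    simp [rayExt, hx]
  have h2 : HasFDerivAt (fun x : R4 => ‖x‖) (innerSL ℝ (p:R4)) (p:R4) := by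
    have a := (hasStrictFDerivAt_norm_sq (p:R4)).hasFDerivAt.sqrt (by simp)
    have e : (fun x : R4 => Real.sqrt (‖x‖^2)) = fun x => ‖x‖ := by
      ext x; exact Real.sqrt_sq (norm_nonneg x)
    rw [e] at a
    refine a.congr_fderiv ?_
    ext v
    simp [hn]
  have h5 : HasFDerivAt (fun x : R4 => ‖x‖⁻¹) (-(innerSL ℝ (p:R4))) (p:R4) := by
    have := (hasDerivAt_inv (x := ‖(p:R4)‖) (by simp)).comp_hasFDerivAt (p:R4) h2
    refine this.congr_fderiv ?_
    simp [hn]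
  have h3 := h5.smul (hasFDerivAt_id (p:R4))
  have h4 := HasFDerivAt.comp (p:R4) (g:=g) (f := fun x : R4 => ‖x‖⁻¹ • x) (by simpa [hn] using hg) h3
  unfold partialD
  rw [h1.fderiv_eq]
  erw [h4.fderiv]
  simp [hn, pos, sub_eq_add_neg, EuclideanSpace.inner_single_right]

theorem partialD_coord (p : S3) (i k : Fin 4) (c : ℝ) :
    partialD (fun q : S3 => c * pos q k) i p = c * ((if i = k then 1 else 0) - pos p i * pos p k) := by
  have := partialD_restrict p (fun x => c * x k) (c • (EuclideanSpace.proj k : R4 →L[ℝ] ℝ)) (by exact ((EuclideanSpace.proj k : R4 →L[ℝ] ℝ).hasFDerivAt).const_mul c) i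
  simp only [pos]
  rw [this]; simp [pos, eq_comm]

theorem dForm_stdContact (p : S3) (X Y : Fin 4 → ℝ) (hX : Tangent p X) (hY : Tangent p Y) :
    dForm stdContact p X Y = 4 * (X 0 * Y 1 - X 1 * Y 0 + X 2 * Y 3 - X 3 * Y 2) := by
  simp only [dForm, Fin.sum_univ_four, stdContact, Matrix.cons_val, partialD_coord]
  simp [Tangent, dotProduct, Fin.sum_univ_four] at hX hY
  simp
  grind

theorem smooth_pos (i : Fin 4) : Smooth (fun p : S3 => pos p i) := by
  have : Fact (Module.finrank ℝ R4 = 3 + 1) := ⟨by simp⟩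
  have h0 : Smooth (fun p : S3 => (p : R4)) := contMDiff_coe_sphere
  exact (EuclideanSpace.proj i : R4 →L[ℝ] ℝ).contMDiff.comp h0

theorem stdJ_eq (p : S3) (X : Fin 4 → ℝ) (hX : InContact p X) : stdJ p *ᵥ X = mulI *ᵥ X := by
  obtain ⟨h1, h2⟩ := hX
  simp [Tangent, stdContact, dotProduct, Fin.sum_univ_four] at h1 h2
  funext a
  fin_cases a <;> simp [dotProduct, Fin.sum_univ_four, stdJ, mulI, Matrix.mulVec, Matrix.mul_apply, Matrix.sub_apply, Matrix.one_apply, Matrix.vecMulVec_apply] <;> grind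

/-- The standard (spherical) CR structure of `S³`. -/
def stdCR : CRStructure where
  J := stdJ
  smooth a b := by
    have c (x : ℝ) : Smooth (fun _ : S3 => x) := contMDiff_const
    simp only [stdJ, Matrix.mul_apply, Matrix.sub_apply, Matrix.vecMulVec_apply, Matrix.mulVec,
      dotProduct, Fin.sum_univ_four]
    have h := smooth_pos
    have hm (u : Fin 4) : Smooth (fun p => mulI u 0 * pos p 0 + mulI u 1 * pos p 1
        + mulI u 2 * pos p 2 + mulI u 3 * pos p 3) :=
      ((((c _).mul (h _)).add ((c _).mul (h _))).add ((c _).mul (h _))).add ((c _).mul (h _))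
    have e (u : Fin 4) := (c (mulI a u)).mul
      (((c ((1 : Matrix (Fin 4) (Fin 4) ℝ) u b)).sub ((h u).mul (h b))).sub ((hm u).mul (hm b)))
    exact (((e 0).add (e 1)).add (e 2)).add (e 3)
  maps p X hX := by
    rw [stdJ_eq p X hX]
    obtain ⟨h1, h2⟩ := hX
    simp [InContact, Tangent, stdContact, dotProduct, Fin.sum_univ_four, mulI, Matrix.mulVec] at *
    constructor <;> grind
  sq p X hX := by
    have h : InContact p (mulI *ᵥ X) := by
      obtain ⟨h1, h2⟩ := hX
      simp [InContact, Tangent, stdContact, dotProduct, Fin.sum_univ_four, mulI, Matrix.mulVec] at *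
      constructor <;> grind
    rw [stdJ_eq p X hX, stdJ_eq p _ h]
    funext a
    fin_cases a <;> simp [mulI, Matrix.mulVec, dotProduct, Fin.sum_univ_four]
  levi_pos p X hX h0 := by
    have h : InContact p (mulI *ᵥ X) := by
      obtain ⟨h1, h2⟩ := hX
      simp [InContact, Tangent, stdContact, dotProduct, Fin.sum_univ_four, mulI, Matrix.mulVec] at *
      constructor <;> grind
    rw [stdJ_eq p X hX, dForm_stdContact p _ _ hX.1 h.1]
    have : ∃ i, X i ≠ 0 := by
      by_contra! hc
      exact h0 (funext hc)
    have hpos : 0 < X 0 ^ 2 + X 1 ^ 2 + X 2 ^ 2 + X 3 ^ 2 := by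
      obtain ⟨i, hi⟩ := this
      fin_cases i <;> simp at hi <;> positivity
    simp [mulI, Matrix.mulVec, dotProduct, Fin.sum_univ_four]
    nlinarith
  normal p := by
    have h := pos_norm p
    funext a
    fin_cases a <;> simp [stdJ, mulI, Matrix.mulVec, dotProduct, Fin.sum_univ_four,
      Matrix.mul_apply, Matrix.sub_apply, Matrix.one_apply, Matrix.vecMulVec_apply] <;> grind
  conormal p := by
    have h := pos_norm p
    funext a
    fin_cases a <;> simp [stdJ, mulI, stdContact, Matrix.mulVec, dotProduct, Fin.sum_univ_four,
      Matrix.mul_apply, Matrix.sub_apply, Matrix.one_apply, Matrix.vecMulVec_apply] <;> grind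

/-- The CR structures `J` and `J'` are `ε`-close in `C^k(S³)`: all derivatives of order at most `k` of
all entries of `J - J'` are less than `ε` in norm, everywhere on `S³`. -/
def CkClose (k : ℕ) (ε : ℝ) (J J' : CRStructure) : Prop :=
  ∀ a b, ∀ j ≤ k, ∀ p : S3,
    ‖iteratedFDeriv ℝ j (rayExt (fun q => J.J q a b - J'.J q a b)) (p : R4)‖ < ε

/-! ### Pseudohermitian geometry -/

/-- The pseudohermitian geometry of `(S³, J, θ)` in a smooth unitary frame: the Reeb field `T`, a unitary
frame `Z = Z₁` of type `(1,0)`, the dual coframe `θ¹`, the connection form `conn = ω₁¹` and the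
torsion coefficient `A = A¹_{1̄}`. Given `J` and `θ`, everything is determined
(on tangent vectors) by the choice of `Z`, which is unique up to a smooth phase. -/
structure UnitaryFrame (J : CRStructure) (θ : S3 → Fin 4 → ℝ) where
  T : S3 → Fin 4 → ℝ
  Z : S3 → Fin 4 → ℂ
  θ1 : S3 → Fin 4 → ℂ
  conn : S3 → Fin 4 → ℂ
  A : S3 → ℂ
  smooth_T : Smooth T
  smooth_Z : Smooth Z
  smooth_θ1 : Smooth θ1
  smooth_conn : Smooth conn
  smooth_A : Smooth A
  /-- `T` is the Reeb vector field: `θ(T) = 1` and `T ⌟ dθ = 0`. -/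
  tangent_T : ∀ p, Tangent p (T p)
  θ_T : ∀ p, θ p ⬝ᵥ T p = 1
  dθ_T : ∀ p V, Tangent p V → dForm θ p (T p) V = 0
  /-- `Z` is a section of the complexified contact bundle with `J Z = i Z`. -/
  tangent_Z : ∀ p, CTangent p (Z p)
  θ_Z : ∀ p, cplx (θ p) ⬝ᵥ Z p = 0
  J_Z : ∀ p, (J.J p).map Complex.ofReal *ᵥ Z p = Complex.I • Z p
  /-- `(θ, θ¹, θ^{1̄})` is the coframe dual to `(T, Z₁, Z_{1̄})`. -/
  θ1_T : ∀ p, θ1 p ⬝ᵥ cplx (T p) = 0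
  θ1_Z : ∀ p, θ1 p ⬝ᵥ Z p = 1
  θ1_Zbar : ∀ p, θ1 p ⬝ᵥ bar (Z p) = 0
  /-- `dθ = i θ¹ ∧ θ^{1̄}`. -/
  dθ_eq : ∀ p V W, CTangent p V → CTangent p W →
    dForm (fun q => cplx (θ q)) p V W
      = Complex.I * ((θ1 p ⬝ᵥ V) * (bar (θ1 p) ⬝ᵥ W) - (θ1 p ⬝ᵥ W) * (bar (θ1 p) ⬝ᵥ V))
  /-- `ω₁¹ + ω_{1̄}^{1̄} = 0`. -/
  conn_skew : ∀ p V, CTangent p V → conn p ⬝ᵥ V + bar (conn p) ⬝ᵥ V = 0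
  /-- `dθ¹ = θ¹ ∧ ω₁¹ + A¹_{1̄} θ ∧ θ^{1̄}`. -/
  dθ1_eq : ∀ p V W, CTangent p V → CTangent p W →
    dForm θ1 p V W
      = ((θ1 p ⬝ᵥ V) * (conn p ⬝ᵥ W) - (θ1 p ⬝ᵥ W) * (conn p ⬝ᵥ V))
        + A p * ((cplx (θ p) ⬝ᵥ V) * (bar (θ1 p) ⬝ᵥ W) - (cplx (θ p) ⬝ᵥ W) * (bar (θ1 p) ⬝ᵥ V))

namespace UnitaryFrame

variable {J : CRStructure} {θ : S3 → Fin 4 → ℝ}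

/-- The vector field `Z_{1̄}`. -/
def Zbar (D : UnitaryFrame J θ) (p : S3) : Fin 4 → ℂ := bar (D.Z p)

/-- The coefficient `A₁₁`, the conjugate of `A_{1̄1̄} = A¹_{1̄}`. -/
def A11 (D : UnitaryFrame J θ) (p : S3) : ℂ := (starRingEnd ℂ) (D.A p)

/-- The covariant derivative `c_{,1}` of the component `c` of a tensor, where `k` is the number of
lower indices `1` minus the number of lower indices `1̄` of `c`. -/
def cov1 (D : UnitaryFrame J θ) (k : ℤ) (c : S3 → ℂ) (p : S3) : ℂ :=
  lieD D.Z c p - (k : ℂ) * (D.conn p ⬝ᵥ D.Z p) * c p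

/-- The covariant derivative `c_{,1̄}`, with `k` as for `cov1`. -/
def covBar (D : UnitaryFrame J θ) (k : ℤ) (c : S3 → ℂ) (p : S3) : ℂ :=
  lieD D.Zbar c p - (k : ℂ) * (D.conn p ⬝ᵥ D.Zbar p) * c p

/-- `φ_{,1̄11} + i A₁₁ φ_{,1̄}`; here `φ_{,1̄}`, `φ_{,1̄1}` and the result have `k = -1, 0, 1`. -/
def P3 (D : UnitaryFrame J θ) (φ : S3 → ℂ) (p : S3) : ℂ :=
  D.cov1 0 (D.cov1 (-1) (D.covBar 0 φ)) p + Complex.I * D.A11 p * D.covBar 0 φ p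

/-- The CR Paneitz operator `P φ = 4 (φ_{,1̄11} + i A₁₁ φ_{,1̄})_{,1̄}`. -/
def paneitz (D : UnitaryFrame J θ) (φ : S3 → ℂ) (p : S3) : ℂ :=
  4 * D.covBar 1 (D.P3 φ) p

end UnitaryFrame

/-- The CR Paneitz operator of `(S³, J, θ)` is non-negative: `∫ φ P φ θ ∧ dθ ≥ 0` for all real smooth
`φ`. The operator `P` does not depend on the unitary frame, and it is a real operator. -/
def PaneitzNonneg (J : CRStructure) (θ : S3 → Fin 4 → ℝ) : Prop :=
  ∀ (D : UnitaryFrame J θ) (φ : S3 → ℝ), Smooth φ →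
    0 ≤ (contactIntegral θ (fun p => (φ p : ℂ) * D.paneitz (fun q => (φ q : ℂ)) p)).re

end CRSphere

end

/-!
The CR structures are the `SU(2)`-invariant ones (the Rossi spheres). Let `R = i z`,
`U = (z̄₂, -z̄₁)`, `V = i U` be the orthonormal frame of `S³` with `[U, V] = -2 R`, `[R, U] = -2 V`,
`[R, V] = 2 U`. For real `α`, `β` with `8 α β = 1`, the structure `invariantCR α β` is the one for
which `Z = α U - i β V` is of type `(1,0)`. It is spherical for `α = β`, and it converges to the
spherical one in every `C^k` as `α` and `β` tend to `1/√8`, since its matrix is a combination of two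
fixed matrix fields with coefficients `8 α²` and `8 β²` (`exists_ckClose`).

For the standard contact form, `Z` is a unitary frame whose connection form vanishes on the contact
bundle and whose torsion is the constant `A = -4 i (β² - α²)`. So the Paneitz operator is
`4 Z̄ (Z Z Z̄ - 4 (β² - α²) Z̄)`. The span of the coordinates is invariant under the frame, and on
the coordinate `x₁` one has `Z Z Z̄ x₁ = (β² - α²) Z̄ x₁` and `Z̄ Z̄ x₁ = (β² - α²) x₁`. Hence
`P x₁ = -12 (β² - α²)² x₁`: the eigenvalue vanishes to second order at the spherical structure, and
is negative everywhere else.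

For the contact form `e^{2f} θ`, an explicit unitary frame `confFrame` with `Z₁ = e^{-f} Z` and
`θ¹ ↦ e^f (θ¹ + 2 i f_{,1̄} θ)` is constructed. Its structure equations (`dForm_conformalContact`,
`dForm_confCoframe`) rest on `[Z, Z̄] = -i T` applied to `f`, which makes the connection form
imaginary. In this frame the terms with derivatives of `f` cancel and `P` becomes `e^{-4f} P`
(`P3_confFrame`, `paneitz_confFrame_pos`), while `θ ∧ dθ` is multiplied by `e^{4f}`
(`contactDensity_conformalContact`). So the quadratic form at `x₁` does not depend on `f`, and is
negative for all conformal factors (`not_paneitzNonneg`).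
-/

open scoped Manifold ContDiff Matrix

namespace CRSphere

/-! ### Differential calculus on the sphere -/

section Calculus

variable {F : Type*} [NormedAddCommGroup F] [NormedSpace ℝ F]

theorem coe_ne_zero (p : S3) : (p : R4) ≠ 0 := by
  intro h
  have hn : ‖(p : R4)‖ = 1 := by simp
  simp [h] at hn

theorem rayExt_coe {F : Type*} [Zero F] (g : S3 → F) (p : S3) : rayExt g (p : R4) = g p := by
  have hn : ‖(p : R4)‖ = 1 := by simp
  simp [rayExt, coe_ne_zero p, hn]

/-- The extension along rays of a smooth function is smooth away from the origin. -/
theorem contDiffAt_rayExt {g : S3 → F} (hg : Smooth g) {x : R4} (hx : x ≠ 0) :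
    ContDiffAt ℝ ∞ (rayExt g) x := by
  have : Fact (Module.finrank ℝ R4 = 3 + 1) := ⟨by simp⟩
  let O : TopologicalSpace.Opens R4 := ⟨{0}ᶜ, isOpen_compl_singleton⟩
  have hne (y : O) : (y : R4) ≠ 0 := y.2
  have hmem (y : O) : ‖(y : R4)‖⁻¹ • (y : R4) ∈ Metric.sphere (0 : R4) 1 := by
    simp [norm_smul, hne y]
  have h1 : ContMDiff 𝓘(ℝ, R4) 𝓘(ℝ, R4) ∞ (fun y : O => ‖(y : R4)‖⁻¹ • (y : R4)) := by
    intro y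
    refine (contMDiffAt_subtype_iff (f := fun y : R4 => ‖y‖⁻¹ • y)).2 ?_
    exact (((contDiffAt_norm ℝ (hne y)).inv (by simpa using hne y)).smul
      contDiffAt_id).contMDiffAt
  have h2 : ContMDiff 𝓘(ℝ, R4) 𝓘(ℝ, F) ∞
      (fun y : O => g ⟨‖(y : R4)‖⁻¹ • (y : R4), hmem y⟩) :=
    ContMDiff.comp hg (h1.codRestrict_sphere hmem)
  have h3 : ContMDiff 𝓘(ℝ, R4) 𝓘(ℝ, F) ∞ (fun y : O => rayExt g (y : R4)) := by
    convert h2 using 2 with y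
    simp [rayExt, hne y]
  exact contMDiffAt_iff_contDiffAt.1 (contMDiffAt_subtype_iff.1 (h3 ⟨x, hx⟩))

theorem differentiableAt_rayExt {g : S3 → F} (hg : Smooth g) (p : S3) :
    DifferentiableAt ℝ (rayExt g) (p : R4) :=
  (contDiffAt_rayExt hg (coe_ne_zero p)).differentiableAt (by simp)

/-- The restriction to the sphere of a function that is smooth away from the origin. -/
theorem smooth_restrict {G : R4 → F} (hG : ∀ p : S3, ContDiffAt ℝ ∞ G (p : R4)) :
    Smooth (fun p : S3 => G p) := by
  have : Fact (Module.finrank ℝ R4 = 3 + 1) := ⟨by simp⟩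
  intro p
  exact ((hG p).contMDiffAt).comp p (contMDiff_coe_sphere (n := 3) p)

theorem contDiffAt_fderiv_rayExt {g : S3 → F} (hg : Smooth g) (p : S3) :
    ContDiffAt ℝ ∞ (fderiv ℝ (rayExt g)) (p : R4) :=
  (contDiffAt_rayExt hg (coe_ne_zero p)).fderiv_right (by simp)

theorem Smooth.partialD {g : S3 → F} (hg : Smooth g) (i : Fin 4) :
    Smooth (CRSphere.partialD g i) :=
  smooth_restrict (G := fun x => fderiv ℝ (rayExt g) x (EuclideanSpace.single i 1))
    fun p => (contDiffAt_fderiv_rayExt hg p).clm_apply contDiffAt_const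

/-- The chain rule, for the composition of a function of one or several variables with smooth
functions on the sphere. -/
theorem partialD_comp {G : Type*} [NormedAddCommGroup G] [NormedSpace ℝ G] {g : S3 → F}
    (hg : Smooth g) {h : F → G} {L : F →L[ℝ] G} (p : S3) (hL : HasFDerivAt h L (g p)) (i : Fin 4) :
    partialD (fun q => h (g q)) i p = L (partialD g i p) := by
  have h1 : rayExt (fun q => h (g q)) =ᶠ[nhds (p : R4)] fun x => h (rayExt g x) := by
    filter_upwards [isOpen_ne.mem_nhds (coe_ne_zero p)] with x hx
    simp only [ne_eq] at hx
    simp [rayExt, hx]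
  have h2 := HasFDerivAt.comp (p : R4) (by rwa [rayExt_coe])
    (differentiableAt_rayExt hg p).hasFDerivAt
  unfold partialD
  rw [h1.fderiv_eq]
  erw [h2.fderiv]
  rfl

theorem partialD_const (c : F) (i : Fin 4) (p : S3) : partialD (fun _ => c) i p = 0 := by
  have := partialD_restrict p (fun _ => c) 0 (hasFDerivAt_const c _) i
  simpa using this

theorem partialD_add {g h : S3 → F} (hg : Smooth g) (hh : Smooth h) (i : Fin 4) (p : S3) :
    partialD (fun q => g q + h q) i p = partialD g i p + partialD h i p := by
  have h1 : rayExt (fun q => g q + h q) = rayExt g + rayExt h := by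
    funext x
    by_cases hx : x = 0 <;> simp [rayExt, hx]
  unfold partialD
  rw [h1, fderiv_add (differentiableAt_rayExt hg p) (differentiableAt_rayExt hh p)]
  rfl

theorem partialD_mul {𝕜 : Type*} [NormedField 𝕜] [NormedAlgebra ℝ 𝕜] {g h : S3 → 𝕜}
    (hg : Smooth g) (hh : Smooth h) (i : Fin 4) (p : S3) :
    partialD (fun q => g q * h q) i p = partialD g i p * h p + g p * partialD h i p := by
  have h1 : rayExt (fun q => g q * h q) = fun x => rayExt g x * rayExt h x := by
    funext x
    by_cases hx : x = 0 <;> simp [rayExt, hx]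
  unfold partialD
  rw [h1, fderiv_fun_mul (differentiableAt_rayExt hg p) (differentiableAt_rayExt hh p)]
  simp [rayExt_coe]
  ring

theorem partialD_ofReal {f : S3 → ℝ} (hf : Smooth f) (i : Fin 4) (p : S3) :
    partialD (fun q => (f q : ℂ)) i p = ((partialD f i p : ℝ) : ℂ) :=
  partialD_comp hf p Complex.ofRealCLM.hasFDerivAt i

theorem partialD_conj {f : S3 → ℂ} (hf : Smooth f) (i : Fin 4) (p : S3) :
    partialD (fun q => (starRingEnd ℂ) (f q)) i p = (starRingEnd ℂ) (partialD f i p) :=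
  partialD_comp hf p (Complex.conjCLE.toContinuousLinearMap.hasFDerivAt) i

end Calculus

/-! ### Smooth functions -/

section Smooth

theorem Smooth.ofReal {f : S3 → ℝ} (hf : Smooth f) : Smooth (fun q => (f q : ℂ)) :=
  ContDiff.comp_contMDiff Complex.ofRealCLM.contDiff hf

theorem Smooth.re {f : S3 → ℂ} (hf : Smooth f) : Smooth (fun q => (f q).re) :=
  ContDiff.comp_contMDiff Complex.reCLM.contDiff hf

theorem Smooth.rexp {f : S3 → ℝ} (hf : Smooth f) : Smooth (fun q => Real.exp (f q)) :=
  ContDiff.comp_contMDiff (g := Real.exp) Real.contDiff_exp hf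

theorem Smooth.cexp {f : S3 → ℂ} (hf : Smooth f) : Smooth (fun q => Complex.exp (f q)) :=
  ContDiff.comp_contMDiff Complex.contDiff_exp hf

theorem smooth_const {F : Type*} [NormedAddCommGroup F] [NormedSpace ℝ F] (c : F) :
    Smooth (fun _ : S3 => c) := contMDiff_const

theorem Smooth.mul' {𝕜 : Type*} [NormedField 𝕜] [NormedAlgebra ℝ 𝕜] {g h : S3 → 𝕜}
    (hg : Smooth g) (hh : Smooth h) : Smooth (fun q => g q * h q) :=
  ContDiff.comp_contMDiff (contDiff_mul (𝕜 := ℝ) (𝔸 := 𝕜)) (hg.prodMk_space hh)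

theorem Smooth.add' {F : Type*} [NormedAddCommGroup F] [NormedSpace ℝ F] {g h : S3 → F}
    (hg : Smooth g) (hh : Smooth h) : Smooth (fun q => g q + h q) :=
  ContMDiff.add hg hh

theorem smooth_pi {F : Type*} [NormedAddCommGroup F] [NormedSpace ℝ F] {V : S3 → Fin 4 → F} :
    Smooth V ↔ ∀ i, Smooth (fun p => V p i) :=
  contMDiff_pi_space

end Smooth

/-! ### Derivatives along vector fields -/

section LieD

theorem lieD_add {V : S3 → Fin 4 → ℂ} {g h : S3 → ℂ} (hg : Smooth g) (hh : Smooth h) (p : S3) :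
    lieD V (fun q => g q + h q) p = lieD V g p + lieD V h p := by
  simp only [lieD, partialD_add hg hh, mul_add, Finset.sum_add_distrib]

theorem lieD_const (V : S3 → Fin 4 → ℂ) (c : ℂ) (p : S3) : lieD V (fun _ => c) p = 0 := by
  simp [lieD, partialD_const]

theorem lieD_mul {V : S3 → Fin 4 → ℂ} {g h : S3 → ℂ} (hg : Smooth g) (hh : Smooth h) (p : S3) :
    lieD V (fun q => g q * h q) p = lieD V g p * h p + g p * lieD V h p := by
  simp only [lieD, partialD_mul hg hh, mul_add, Finset.sum_add_distrib, Finset.sum_mul,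
    Finset.mul_sum]
  congr 1 <;> refine Finset.sum_congr rfl fun i _ => by ring

theorem lieD_const_mul {V : S3 → Fin 4 → ℂ} (c : ℂ) {g : S3 → ℂ} (hg : Smooth g) (p : S3) :
    lieD V (fun q => c * g q) p = c * lieD V g p := by
  rw [lieD_mul (smooth_const c) hg, lieD_const]
  ring

theorem lieD_cexp {V : S3 → Fin 4 → ℂ} {g : S3 → ℂ} (hg : Smooth g) (p : S3) :
    lieD V (fun q => Complex.exp (g q)) p = Complex.exp (g p) * lieD V g p := by
  have h (i : Fin 4) := partialD_comp hg p
    ((Complex.hasDerivAt_exp (g p)).hasFDerivAt.restrictScalars ℝ) i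
  simp only [lieD, h, Finset.mul_sum]
  refine Finset.sum_congr rfl fun i _ => ?_
  simp
  ring

theorem lieD_conj {V : S3 → Fin 4 → ℂ} {g : S3 → ℂ} (hg : Smooth g) (p : S3) :
    lieD (fun q => bar (V q)) (fun q => (starRingEnd ℂ) (g q)) p
      = (starRingEnd ℂ) (lieD V g p) := by
  simp [lieD, partialD_conj hg, bar]

theorem Smooth.lieD {V : S3 → Fin 4 → ℂ} {g : S3 → ℂ} (hV : Smooth V) (hg : Smooth g) :
    Smooth (CRSphere.lieD V g) := by
  have h (i : Fin 4) : Smooth (fun p => V p i * CRSphere.partialD g i p) :=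
    (smooth_pi.1 hV i).mul' (hg.partialD i)
  unfold CRSphere.lieD
  simp only [Fin.sum_univ_four]
  exact (((h 0).add' (h 1)).add' (h 2)).add' (h 3)

/-- The linear vector field `p ↦ M p`. -/
noncomputable def linField (M : Matrix (Fin 4) (Fin 4) ℝ) (p : S3) : Fin 4 → ℂ := cplx (M *ᵥ pos p)

theorem fderiv_eq_sum {F : Type*} [NormedAddCommGroup F] [NormedSpace ℝ F] (L : R4 →L[ℝ] F)
    (v : R4) : L v = ∑ i, v i • L (EuclideanSpace.single i 1) := by
  conv_lhs => rw [← (EuclideanSpace.basisFun (Fin 4) ℝ).sum_repr v]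
  simp

theorem lieD_linField (M : Matrix (Fin 4) (Fin 4) ℝ) (g : S3 → ℂ) (p : S3) :
    lieD (linField M) g p = fderiv ℝ (rayExt g) (p : R4) (Matrix.toEuclideanCLM (𝕜 := ℝ) M p) := by
  rw [fderiv_eq_sum]
  simp only [lieD, partialD]
  refine Finset.sum_congr rfl fun i _ => ?_
  rw [Complex.real_smul]
  rfl

/-- The derivative along a linear field tangent to the sphere of a function given on `ℝ⁴`. -/
theorem lieD_linField_restrict {M : Matrix (Fin 4) (Fin 4) ℝ} {p : S3} (hM : Tangent p (M *ᵥ pos p))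
    (g : R4 → ℂ) (L : R4 →L[ℝ] ℂ) (hg : HasFDerivAt g L (p : R4)) :
    lieD (linField M) (fun q : S3 => g q) p = L (Matrix.toEuclideanCLM (𝕜 := ℝ) M p) := by
  have h : ∑ i, ((M *ᵥ pos p) i : ℂ) * (pos p i : ℂ) = 0 := by
    rw [Tangent, dotProduct_comm] at hM
    exact_mod_cast hM
  simp only [lieD, partialD_restrict p g L hg, map_sub, map_smul, linField, cplx, mul_sub,
    Finset.sum_sub_distrib, Complex.real_smul, ← mul_assoc, ← Finset.sum_mul]
  rw [h, zero_mul, sub_zero, fderiv_eq_sum L]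
  refine Finset.sum_congr rfl fun i _ => ?_
  rw [Complex.real_smul]
  rfl

/-- The Lie bracket of two linear vector fields tangent to the sphere is minus the commutator of
their matrices. -/
theorem lieD_linField_comm {M N : Matrix (Fin 4) (Fin 4) ℝ}
    (hM : ∀ p : S3, Tangent p (M *ᵥ pos p)) (hN : ∀ p : S3, Tangent p (N *ᵥ pos p))
    {g : S3 → ℂ} (hg : Smooth g) (p : S3) :
    lieD (linField M) (lieD (linField N) g) p - lieD (linField N) (lieD (linField M) g) p
      = lieD (linField (N * M - M * N)) g p := by
  have key (A B : Matrix (Fin 4) (Fin 4) ℝ) (hA : Tangent p (A *ᵥ pos p)) :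
      lieD (linField A) (lieD (linField B) g) p
        = fderiv ℝ (fderiv ℝ (rayExt g)) (p : R4) (Matrix.toEuclideanCLM (𝕜 := ℝ) A p)
            (Matrix.toEuclideanCLM (𝕜 := ℝ) B p)
          + fderiv ℝ (rayExt g) (p : R4) (Matrix.toEuclideanCLM (𝕜 := ℝ) (B * A) p) := by
    have h1 : lieD (linField B) g = fun q : S3 =>
        fderiv ℝ (rayExt g) (q : R4) (Matrix.toEuclideanCLM (𝕜 := ℝ) B q) :=
      funext fun q => lieD_linField B g q
    have h2 : DifferentiableAt ℝ (fderiv ℝ (rayExt g)) (p : R4) :=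
      (contDiffAt_fderiv_rayExt hg p).differentiableAt (by simp)
    rw [h1, lieD_linField_restrict hA _ _ (h2.hasFDerivAt.clm_apply
      (Matrix.toEuclideanCLM (𝕜 := ℝ) B).hasFDerivAt)]
    simp [add_comm]
  have hs : IsSymmSndFDerivAt ℝ (rayExt g) (p : R4) :=
    (contDiffAt_rayExt hg (coe_ne_zero p)).isSymmSndFDerivAt (by
      rw [minSmoothness_of_isRCLikeNormedField]
      exact WithTop.coe_le_coe.2 (le_top (a := (2 : ℕ∞))))
  rw [key M N (hM p), key N M (hN p), lieD_linField, map_sub, hs.eq]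
  simp

end LieD

/-! ### Exterior derivatives of `1`-forms -/

section Forms

theorem dForm_add {η ζ : S3 → Fin 4 → ℂ} (hη : Smooth η) (hζ : Smooth ζ) (p : S3)
    (V W : Fin 4 → ℂ) : dForm (fun q => η q + ζ q) p V W = dForm η p V W + dForm ζ p V W := by
  have h (i j : Fin 4) : partialD (fun q => (η q + ζ q) j) i p
      = partialD (fun q => η q j) i p + partialD (fun q => ζ q j) i p :=
    partialD_add (smooth_pi.1 hη j) (smooth_pi.1 hζ j) i p
  simp only [dForm, h, add_mul, Finset.sum_add_distrib]

/-- The Leibniz rule `d(g η) = dg ∧ η + g dη`. -/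
theorem dForm_smul {g : S3 → ℂ} {η : S3 → Fin 4 → ℂ} (hg : Smooth g) (hη : Smooth η) (p : S3)
    (V W : Fin 4 → ℂ) :
    dForm (fun q => g q • η q) p V W
      = lieD (fun _ => V) g p * (η p ⬝ᵥ W) - lieD (fun _ => W) g p * (η p ⬝ᵥ V)
        + g p * dForm η p V W := by
  have h (i j : Fin 4) : partialD (fun q => (g q • η q) j) i p
      = partialD g i p * η p j + g p * partialD (fun q => η q j) i p :=
    partialD_mul hg (smooth_pi.1 hη j) i p
  simp only [dForm, h, lieD, dotProduct, Fin.sum_univ_four]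
  ring

theorem dForm_const_smul (c : ℂ) {η : S3 → Fin 4 → ℂ} (hη : Smooth η) (p : S3)
    (V W : Fin 4 → ℂ) : dForm (fun q => c • η q) p V W = c * dForm η p V W := by
  rw [dForm_smul (smooth_const c) hη, lieD_const, lieD_const]
  ring

theorem dForm_ofReal {η : S3 → Fin 4 → ℝ} (hη : Smooth η) (p : S3) (V W : Fin 4 → ℝ) :
    dForm (fun q => cplx (η q)) p (cplx V) (cplx W) = ((dForm η p V W : ℝ) : ℂ) := by
  have h (i j : Fin 4) : partialD (fun q => cplx (η q) j) i p
      = ((partialD (fun q => η q j) i p : ℝ) : ℂ) := partialD_ofReal (smooth_pi.1 hη j) i p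
  simp only [dForm, h]
  simp [cplx]

theorem smooth_mulVec (M : Matrix (Fin 4) (Fin 4) ℝ) : Smooth (fun p => M *ᵥ pos p) := by
  refine smooth_pi.2 fun i => ?_
  simp only [Matrix.mulVec, dotProduct, Fin.sum_univ_four]
  have h (j : Fin 4) : Smooth (fun p : S3 => M i j * pos p j) :=
    (smooth_const _).mul' (smooth_pos j)
  exact (((h 0).add' (h 1)).add' (h 2)).add' (h 3)

theorem smooth_linField (M : Matrix (Fin 4) (Fin 4) ℝ) : Smooth (linField M) :=
  smooth_pi.2 fun i => (smooth_pi.1 (smooth_mulVec M) i).ofReal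

theorem dForm_linField (M : Matrix (Fin 4) (Fin 4) ℝ) (p : S3) {V W : Fin 4 → ℂ}
    (hV : CTangent p V) (hW : CTangent p W) :
    dForm (linField M) p V W = ∑ i, ∑ j, (M j i : ℂ) * (V i * W j - W i * V j) := by
  have h (i j : Fin 4) : partialD (fun q => linField M q j) i p
      = ((M j i : ℝ) : ℂ) - (pos p i : ℂ) * (((M *ᵥ pos p) j : ℝ) : ℂ) := by
    let L : R4 →L[ℝ] ℂ := Complex.ofRealCLM ∘L
      ((EuclideanSpace.proj j : R4 →L[ℝ] ℝ) ∘L Matrix.toEuclideanCLM (𝕜 := ℝ) M)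
    have h1 := partialD_restrict p L L L.hasFDerivAt i
    have h2 (x : R4) : L x = (((M *ᵥ x.ofLp) j : ℝ) : ℂ) := rfl
    have h3 : partialD (fun q => linField M q j) i p = partialD (fun q : S3 => L q) i p := rfl
    rw [h3, h1, map_sub, map_smul, h2, h2, Complex.real_smul]
    simp [pos]
    exact Or.inl rfl
  simp only [CTangent, dotProduct, cplx, Fin.sum_univ_four] at hV hW
  simp only [dForm, h, Fin.sum_univ_four]
  generalize (((M *ᵥ pos p) 0 : ℝ) : ℂ) = m0
  generalize (((M *ᵥ pos p) 1 : ℝ) : ℂ) = m1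
  generalize (((M *ᵥ pos p) 2 : ℝ) : ℂ) = m2
  generalize (((M *ᵥ pos p) 3 : ℝ) : ℂ) = m3
  linear_combination (-m0 * W 0 - m1 * W 1 - m2 * W 2 - m3 * W 3) * hV
    + (m0 * V 0 + m1 * V 1 + m2 * V 2 + m3 * V 3) * hW

end Forms

/-! ### The invariant frame of the sphere -/

section Frame

/-- The matrix of a unit field `U` in the contact bundle, invariant under the action of `SU(2)`; in
complex notation `U = (z̄₂, -z̄₁)`. -/
def matU : Matrix (Fin 4) (Fin 4) ℝ := !![0, 0, 1, 0; 0, 0, 0, -1; -1, 0, 0, 0; 0, 1, 0, 0]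

/-- The matrix of the field `V = i U`. -/
def matV : Matrix (Fin 4) (Fin 4) ℝ := !![0, 0, 0, 1; 0, 0, 1, 0; 0, -1, 0, 0; -1, 0, 0, 0]

theorem mulI_mulVec (x : Fin 4 → ℝ) : mulI *ᵥ x = ![-x 1, x 0, -x 3, x 2] := by
  funext i
  fin_cases i <;> simp [mulI, Matrix.mulVec, dotProduct, Fin.sum_univ_four]

theorem matU_mulVec (x : Fin 4 → ℝ) : matU *ᵥ x = ![x 2, -x 3, -x 0, x 1] := by
  funext i
  fin_cases i <;> simp [matU, Matrix.mulVec, dotProduct, Fin.sum_univ_four]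

theorem matV_mulVec (x : Fin 4 → ℝ) : matV *ᵥ x = ![x 3, x 2, -x 1, -x 0] := by
  funext i
  fin_cases i <;> simp [matV, Matrix.mulVec, dotProduct, Fin.sum_univ_four]

theorem tangent_mulI (p : S3) : Tangent p (mulI *ᵥ pos p) := by
  simp [Tangent, mulI_mulVec, dotProduct, Fin.sum_univ_four]
  ring

theorem tangent_matU (p : S3) : Tangent p (matU *ᵥ pos p) := by
  simp [Tangent, matU_mulVec, dotProduct, Fin.sum_univ_four]
  ring

theorem tangent_matV (p : S3) : Tangent p (matV *ᵥ pos p) := by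
  simp [Tangent, matV_mulVec, dotProduct, Fin.sum_univ_four]
  ring

theorem linField_mulI (p : S3) : linField mulI p = ![-(pos p 1 : ℂ), pos p 0, -pos p 3, pos p 2] := by
  funext i
  fin_cases i <;> simp [linField, cplx, mulI_mulVec]

theorem linField_matU (p : S3) : linField matU p = ![(pos p 2 : ℂ), -pos p 3, -pos p 0, pos p 1] := by
  funext i
  fin_cases i <;> simp [linField, cplx, matU_mulVec]

theorem linField_matV (p : S3) : linField matV p = ![(pos p 3 : ℂ), pos p 2, -pos p 1, -pos p 0] := by
  funext i
  fin_cases i <;> simp [linField, cplx, matV_mulVec]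

theorem pos_norm_complex (p : S3) :
    (pos p 0 : ℂ) ^ 2 + (pos p 1 : ℂ) ^ 2 + (pos p 2 : ℂ) ^ 2 + (pos p 3 : ℂ) ^ 2 = 1 := by
  exact_mod_cast pos_norm p

/-- The fields `mulI`, `matU`, `matV` form an orthonormal frame of the tangent bundle. -/
theorem eq_sum_linField {p : S3} {V : Fin 4 → ℂ} (hV : CTangent p V) :
    V = (linField mulI p ⬝ᵥ V) • linField mulI p + (linField matU p ⬝ᵥ V) • linField matU p
      + (linField matV p ⬝ᵥ V) • linField matV p := by
  have h := pos_norm_complex p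
  simp only [CTangent, dotProduct, cplx, Fin.sum_univ_four] at hV
  funext i
  fin_cases i
  · simp [linField_mulI, linField_matU, linField_matV, dotProduct, Fin.sum_univ_four]
    linear_combination (-V 0) * h + (pos p 0 : ℂ) * hV
  · simp [linField_mulI, linField_matU, linField_matV, dotProduct, Fin.sum_univ_four]
    linear_combination (-V 1) * h + (pos p 1 : ℂ) * hV
  · simp [linField_mulI, linField_matU, linField_matV, dotProduct, Fin.sum_univ_four]
    linear_combination (-V 2) * h + (pos p 2 : ℂ) * hV
  · simp [linField_mulI, linField_matU, linField_matV, dotProduct, Fin.sum_univ_four]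
    linear_combination (-V 3) * h + (pos p 3 : ℂ) * hV

theorem dForm_mulI {p : S3} {V W : Fin 4 → ℂ} (hV : CTangent p V) (hW : CTangent p W) :
    dForm (linField mulI) p V W
      = 2 * ((linField matU p ⬝ᵥ V) * (linField matV p ⬝ᵥ W)
        - (linField matU p ⬝ᵥ W) * (linField matV p ⬝ᵥ V)) := by
  have h := pos_norm_complex p
  rw [dForm_linField _ _ hV hW]
  simp only [CTangent, dotProduct, cplx, Fin.sum_univ_four] at hV hW
  simp [linField_matU, linField_matV, dotProduct, Fin.sum_univ_four, mulI]
  grind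

theorem dForm_matU {p : S3} {V W : Fin 4 → ℂ} (hV : CTangent p V) (hW : CTangent p W) :
    dForm (linField matU) p V W
      = -2 * ((linField mulI p ⬝ᵥ V) * (linField matV p ⬝ᵥ W)
        - (linField mulI p ⬝ᵥ W) * (linField matV p ⬝ᵥ V)) := by
  have h := pos_norm_complex p
  rw [dForm_linField _ _ hV hW]
  simp only [CTangent, dotProduct, cplx, Fin.sum_univ_four] at hV hW
  simp [linField_mulI, linField_matV, dotProduct, Fin.sum_univ_four, matU]
  grind

theorem dForm_matV {p : S3} {V W : Fin 4 → ℂ} (hV : CTangent p V) (hW : CTangent p W) :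
    dForm (linField matV) p V W
      = 2 * ((linField mulI p ⬝ᵥ V) * (linField matU p ⬝ᵥ W)
        - (linField mulI p ⬝ᵥ W) * (linField matU p ⬝ᵥ V)) := by
  have h := pos_norm_complex p
  rw [dForm_linField _ _ hV hW]
  simp only [CTangent, dotProduct, cplx, Fin.sum_univ_four] at hV hW
  simp [linField_mulI, linField_matU, dotProduct, Fin.sum_univ_four, matV]
  grind

end Frame

/-! ### The left-invariant CR structures -/

section Structure

theorem eq_of_inContact {p : S3} {X : Fin 4 → ℝ} (hX : InContact p X) :
    X = ((matU *ᵥ pos p) ⬝ᵥ X) • (matU *ᵥ pos p) + ((matV *ᵥ pos p) ⬝ᵥ X) • (matV *ᵥ pos p) := by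
  have h := pos_norm p
  obtain ⟨h1, h2⟩ := hX
  simp [Tangent, stdContact, dotProduct, Fin.sum_univ_four] at h1 h2
  funext i
  fin_cases i
  · simp [matU_mulVec, matV_mulVec, dotProduct, Fin.sum_univ_four]
    linear_combination (-X 0) * h + pos p 0 * h1 - pos p 1 / 2 * h2
  · simp [matU_mulVec, matV_mulVec, dotProduct, Fin.sum_univ_four]
    linear_combination (-X 1) * h + pos p 1 * h1 + pos p 0 / 2 * h2
  · simp [matU_mulVec, matV_mulVec, dotProduct, Fin.sum_univ_four]
    linear_combination (-X 2) * h + pos p 2 * h1 - pos p 3 / 2 * h2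
  · simp [matU_mulVec, matV_mulVec, dotProduct, Fin.sum_univ_four]
    linear_combination (-X 3) * h + pos p 3 * h1 + pos p 2 / 2 * h2

theorem inContact_matU (p : S3) : InContact p (matU *ᵥ pos p) := by
  refine ⟨tangent_matU p, ?_⟩
  simp [stdContact, matU_mulVec, dotProduct, Fin.sum_univ_four]
  ring

theorem inContact_matV (p : S3) : InContact p (matV *ᵥ pos p) := by
  refine ⟨tangent_matV p, ?_⟩
  simp [stdContact, matV_mulVec, dotProduct, Fin.sum_univ_four]
  ring

theorem InContact.smul_add_smul {p : S3} {X Y : Fin 4 → ℝ} (hX : InContact p X)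
    (hY : InContact p Y) (a b : ℝ) : InContact p (a • X + b • Y) := by
  obtain ⟨h1, h2⟩ := hX
  obtain ⟨h3, h4⟩ := hY
  simp only [Tangent] at h1 h3
  constructor <;> simp [Tangent, h1, h2, h3, h4]

/-- The endomorphism of the contact bundle that maps `U` to `8 β² V` and `V` to `-8 α² U`. -/
noncomputable def invariantJ (α β : ℝ) (p : S3) : Matrix (Fin 4) (Fin 4) ℝ :=
  (8 * β ^ 2) • Matrix.vecMulVec (matV *ᵥ pos p) (matU *ᵥ pos p)
    - (8 * α ^ 2) • Matrix.vecMulVec (matU *ᵥ pos p) (matV *ᵥ pos p)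

theorem invariantJ_mulVec (α β : ℝ) (p : S3) (X : Fin 4 → ℝ) :
    invariantJ α β p *ᵥ X = (-(8 * α ^ 2) * ((matV *ᵥ pos p) ⬝ᵥ X)) • (matU *ᵥ pos p)
      + ((8 * β ^ 2) * ((matU *ᵥ pos p) ⬝ᵥ X)) • (matV *ᵥ pos p) := by
  funext i
  simp only [invariantJ, Matrix.mulVec, dotProduct, Fin.sum_univ_four, Matrix.sub_apply,
    Matrix.smul_apply, Matrix.vecMulVec_apply, Pi.add_apply, Pi.smul_apply, smul_eq_mul]
  ring

theorem matU_dot_matU (p : S3) : (matU *ᵥ pos p) ⬝ᵥ (matU *ᵥ pos p) = 1 := by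
  rw [← pos_norm p]
  simp [matU_mulVec, dotProduct, Fin.sum_univ_four]
  ring

theorem matV_dot_matV (p : S3) : (matV *ᵥ pos p) ⬝ᵥ (matV *ᵥ pos p) = 1 := by
  rw [← pos_norm p]
  simp [matV_mulVec, dotProduct, Fin.sum_univ_four]
  ring

theorem matU_dot_matV (p : S3) : (matU *ᵥ pos p) ⬝ᵥ (matV *ᵥ pos p) = 0 := by
  simp [matU_mulVec, matV_mulVec, dotProduct, Fin.sum_univ_four]
  ring

/-- The `SU(2)`-invariant CR structure on `S³` for which `α U - i β V` is of type `(1,0)`. For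
`α = β` it is the spherical one. The normalization `8 α β = 1` makes that field unitary for the
standard contact form. -/
noncomputable def invariantCR (α β : ℝ) (h : 8 * α * β = 1) : CRStructure where
  J := invariantJ α β
  smooth a b := by
    have hU := smooth_pi.1 (smooth_mulVec matU)
    have hV := smooth_pi.1 (smooth_mulVec matV)
    simp only [invariantJ, Matrix.sub_apply, Matrix.smul_apply, Matrix.vecMulVec_apply,
      smul_eq_mul]
    exact ContMDiff.sub ((smooth_const _).mul' ((hV a).mul' (hU b)))
      ((smooth_const _).mul' ((hU a).mul' (hV b)))
  maps p X _ := by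
    rw [invariantJ_mulVec]
    exact (inContact_matU p).smul_add_smul (inContact_matV p) _ _
  sq p X hX := by
    rw [invariantJ_mulVec, invariantJ_mulVec]
    conv_rhs => rw [eq_of_inContact hX]
    have h' : (matV *ᵥ pos p) ⬝ᵥ (matU *ᵥ pos p) = 0 := by rw [dotProduct_comm, matU_dot_matV]
    simp only [dotProduct_add, dotProduct_smul, matU_dot_matU, matV_dot_matV, matU_dot_matV, h',
      smul_eq_mul]
    generalize (matU *ᵥ pos p) ⬝ᵥ X = u
    generalize (matV *ᵥ pos p) ⬝ᵥ X = v
    funext i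
    simp only [Pi.add_apply, Pi.smul_apply, Pi.neg_apply, smul_eq_mul]
    linear_combination (-(u * (matU *ᵥ pos p) i) - v * (matV *ᵥ pos p) i) * (8 * α * β + 1) * h
  levi_pos p X hX h0 := by
    have hJ : Tangent p (invariantJ α β p *ᵥ X) := by
      rw [invariantJ_mulVec]
      exact ((inContact_matU p).smul_add_smul (inContact_matV p) _ _).1
    have hα : α ≠ 0 := by rintro rfl; simp at h
    have hβ : β ≠ 0 := by rintro rfl; simp at h
    have hX' := eq_of_inContact hX
    rw [dForm_stdContact p _ _ hX.1 hJ, invariantJ_mulVec]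
    have hn := pos_norm p
    set u := (matU *ᵥ pos p) ⬝ᵥ X
    set v := (matV *ᵥ pos p) ⬝ᵥ X
    have huv : u ≠ 0 ∨ v ≠ 0 := by
      by_contra! hc
      rw [hc.1, hc.2] at hX'
      simp at hX'
      exact h0 hX'
    have hpos : 0 < 32 * (β ^ 2 * u ^ 2 + α ^ 2 * v ^ 2) := by
      rcases huv with hu | hv <;> positivity
    refine hpos.trans_eq ?_
    rw [hX']
    simp [matU_mulVec, matV_mulVec]
    linear_combination (-32 * (β ^ 2 * u ^ 2 + α ^ 2 * v ^ 2)) * hn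
  normal p := by
    have h1 := tangent_matU p
    have h2 := tangent_matV p
    simp only [Tangent] at h1 h2
    rw [invariantJ_mulVec, dotProduct_comm, h2, dotProduct_comm, h1]
    simp
  conormal p := by
    have h1 := (inContact_matU p).2
    have h2 := (inContact_matV p).2
    rw [invariantJ_mulVec, dotProduct_comm, h2, dotProduct_comm, h1]
    simp

end Structure

/-! ### Closeness to the spherical structure -/

section Close

theorem stdJ_eq_vecMulVec (p : S3) :
    stdJ p = Matrix.vecMulVec (matV *ᵥ pos p) (matU *ᵥ pos p)
      - Matrix.vecMulVec (matU *ᵥ pos p) (matV *ᵥ pos p) := by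
  have h := pos_norm p
  ext a b
  simp only [stdJ, mulI_mulVec, matU_mulVec, matV_mulVec]
  fin_cases a <;> fin_cases b <;>
    simp [mulI, Matrix.mul_apply, Fin.sum_univ_four, Matrix.vecMulVec_apply, Matrix.one_apply] <;>
    grind

/-- All derivatives of the extension of a smooth function along rays are bounded on the sphere. -/
theorem exists_bound_iteratedFDeriv {g : S3 → ℝ} (hg : Smooth g) (j : ℕ) :
    ∃ C, ∀ p : S3, ‖iteratedFDeriv ℝ j (rayExt g) (p : R4)‖ ≤ C := by
  have hc : Continuous fun p : S3 => iteratedFDeriv ℝ j (rayExt g) (p : R4) := by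
    refine continuous_iff_continuousAt.2 fun p => ?_
    have h : ContinuousAt (iteratedFDeriv ℝ j (rayExt g)) (p : R4) :=
      (((contDiffAt_rayExt hg (coe_ne_zero p)).iteratedFDeriv_right (i := j) (m := 0)
        (by simpa using ENat.LEInfty.out)).continuousAt)
    exact h.comp continuous_subtype_val.continuousAt
  obtain ⟨C, hC⟩ := (isCompact_range hc.norm).bddAbove
  exact ⟨C, fun p => hC ⟨p, rfl⟩⟩

theorem norm_iteratedFDeriv_rayExt_le {g h : S3 → ℝ} (hg : Smooth g) (hh : Smooth h) (j : ℕ)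
    (p : S3) (a b : ℝ) :
    ‖iteratedFDeriv ℝ j (rayExt fun q => a * g q + b * h q) (p : R4)‖
      ≤ |a| * ‖iteratedFDeriv ℝ j (rayExt g) (p : R4)‖
        + |b| * ‖iteratedFDeriv ℝ j (rayExt h) (p : R4)‖ := by
  have e : (rayExt fun q => a * g q + b * h q) = a • rayExt g + b • rayExt h := by
    funext x
    by_cases hx : x = 0 <;> simp [rayExt, hx]
  have h1 : ContDiffAt ℝ j (rayExt g) (p : R4) :=
    (contDiffAt_rayExt hg (coe_ne_zero p)).of_le (by exact_mod_cast le_top)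
  have h2 : ContDiffAt ℝ j (rayExt h) (p : R4) :=
    (contDiffAt_rayExt hh (coe_ne_zero p)).of_le (by exact_mod_cast le_top)
  rw [e, iteratedFDeriv_add_apply (f := a • rayExt g) (g := b • rayExt h) (h1.const_smul a)
    (h2.const_smul b), iteratedFDeriv_const_smul_apply h1, iteratedFDeriv_const_smul_apply h2]
  refine (norm_add_le _ _).trans ?_
  simp [norm_smul]

/-- The invariant CR structures converge to the spherical one in `C^k` as `α` and `β` tend to
`1/√8`. -/
theorem exists_ckClose (k : ℕ) {ε : ℝ} (hε : 0 < ε) :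
    ∃ (α β : ℝ) (h : 8 * α * β = 1), α ^ 2 ≠ β ^ 2 ∧ CkClose k ε (invariantCR α β h) stdCR := by
  have hU := smooth_pi.1 (smooth_mulVec matU)
  have hV := smooth_pi.1 (smooth_mulVec matV)
  let g (a b : Fin 4) (q : S3) : ℝ := (matV *ᵥ pos q) a * (matU *ᵥ pos q) b
  let h (a b : Fin 4) (q : S3) : ℝ := (matU *ᵥ pos q) a * (matV *ᵥ pos q) b
  have hg (a b : Fin 4) : Smooth (g a b) := (hV a).mul' (hU b)
  have hh (a b : Fin 4) : Smooth (h a b) := (hU a).mul' (hV b)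
  choose C hC using fun a b j => exists_bound_iteratedFDeriv (hg a b) j
  choose D hD using fun a b j => exists_bound_iteratedFDeriv (hh a b) j
  let S : ℝ := ∑ a, ∑ b, ∑ j ∈ Finset.range (k + 1), (|C a b j| + |D a b j|)
  have hS (a b : Fin 4) (j : ℕ) (hj : j ≤ k) : |C a b j| + |D a b j| ≤ S := by
    refine le_trans ?_ (Finset.single_le_sum (f := fun a => ∑ b, ∑ j ∈ Finset.range (k + 1),
      (|C a b j| + |D a b j|)) (fun _ _ => by positivity) (Finset.mem_univ a))
    refine le_trans ?_ (Finset.single_le_sum (f := fun b => ∑ j ∈ Finset.range (k + 1),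
      (|C a b j| + |D a b j|)) (fun _ _ => by positivity) (Finset.mem_univ b))
    exact Finset.single_le_sum (f := fun j => |C a b j| + |D a b j|)
      (fun _ _ => by positivity) (Finset.mem_range.2 (by omega))
  have hS0 : 0 ≤ S := by positivity
  -- With `8 β² = 1 + δ` and `8 α² = (1 + δ)⁻¹`, both coefficients of the difference are at most `δ`.
  let δ : ℝ := ε / (S + 1)
  have hδ : 0 < δ := by positivity
  let β : ℝ := √((1 + δ) / 8)
  have hβ2 : 8 * β ^ 2 = 1 + δ := by
    rw [Real.sq_sqrt (by positivity)]
    ring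
  have hβ : 0 < β := Real.sqrt_pos.2 (by positivity)
  let α : ℝ := 1 / (8 * β)
  have hαβ : 8 * α * β = 1 := by
    simp only [α]
    field_simp
  have hα2 : 8 * α ^ 2 * (1 + δ) = 1 := by
    linear_combination (8 * α * β + 1) * hαβ - 8 * α ^ 2 * hβ2
  have hα1 : |1 - 8 * α ^ 2| ≤ δ := by
    rw [abs_le]
    constructor <;> nlinarith [sq_nonneg α]
  refine ⟨α, β, hαβ, fun heq => ?_, fun a b j hj p => ?_⟩
  · rw [heq] at hα2
    nlinarith
  · have e : (fun q => (invariantCR α β hαβ).J q a b - stdCR.J q a b)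
        = fun q => δ * g a b q + (1 - 8 * α ^ 2) * h a b q := by
      funext q
      have : stdCR.J q = stdJ q := rfl
      rw [this, stdJ_eq_vecMulVec]
      simp only [invariantCR, invariantJ, Matrix.sub_apply, Matrix.smul_apply, smul_eq_mul,
        Matrix.vecMulVec_apply, g, h]
      linear_combination ((matV *ᵥ pos q) a * (matU *ᵥ pos q) b) * hβ2
    rw [e]
    refine (norm_iteratedFDeriv_rayExt_le (hg a b) (hh a b) j p _ _).trans_lt ?_
    have h1 := (hC a b j p).trans (le_abs_self _)
    have h2 := (hD a b j p).trans (le_abs_self _)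
    calc _ ≤ δ * |C a b j| + δ * |D a b j| := by
          rw [abs_of_pos hδ]
          gcongr
      _ = δ * (|C a b j| + |D a b j|) := by ring
      _ ≤ δ * S := by
          gcongr
          exact hS a b j hj
      _ < δ * (S + 1) := by
          gcongr
          linarith
      _ = ε := by
          simp only [δ]
          field_simp

end Close

/-! ### Conformal changes of the unitary frame -/

section Frames

variable {α β : ℝ} {f : S3 → ℝ}

/-- The field `α U - i β V`. -/
noncomputable def frameZ (α β : ℝ) (p : S3) : Fin 4 → ℂ :=
  (α : ℂ) • linField matU p - (Complex.I * β) • linField matV p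

/-- The conjugate field `α U + i β V`. -/
noncomputable def frameZbar (α β : ℝ) (p : S3) : Fin 4 → ℂ :=
  (α : ℂ) • linField matU p + (Complex.I * β) • linField matV p

/-- The `1`-form `θ¹` dual to `frameZ α β`, when `8 α β = 1`. -/
noncomputable def coframe (α β : ℝ) (p : S3) : Fin 4 → ℂ :=
  (4 * β : ℂ) • linField matU p + (4 * Complex.I * α) • linField matV p

/-- The conjugate of `coframe α β`. -/
noncomputable def coframeBar (α β : ℝ) (p : S3) : Fin 4 → ℂ :=
  (4 * β : ℂ) • linField matU p - (4 * Complex.I * α) • linField matV p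

theorem bar_linField (M : Matrix (Fin 4) (Fin 4) ℝ) (p : S3) : bar (linField M p) = linField M p := by
  funext i
  simp [bar, linField, cplx]

theorem bar_smul (c : ℂ) (V : Fin 4 → ℂ) : bar (c • V) = (starRingEnd ℂ) c • bar V := by
  funext i
  simp [bar]

theorem bar_add (V W : Fin 4 → ℂ) : bar (V + W) = bar V + bar W := by
  funext i
  simp [bar]

theorem bar_sub (V W : Fin 4 → ℂ) : bar (V - W) = bar V - bar W := by
  funext i
  simp [bar]

theorem bar_frameZ (p : S3) : bar (frameZ α β p) = frameZbar α β p := by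
  simp [frameZ, frameZbar, bar_sub, bar_smul, bar_linField, -Complex.coe_smul]

theorem bar_coframe (p : S3) : bar (coframe α β p) = coframeBar α β p := by
  simp [coframe, coframeBar, bar_add, bar_smul, bar_linField, sub_eq_add_neg, map_ofNat]

theorem bar_coframeBar (p : S3) : bar (coframeBar α β p) = coframe α β p := by
  simp [coframe, coframeBar, bar_sub, bar_smul, bar_linField, map_ofNat]

theorem lieD_smul_field (c : S3 → ℂ) (V : S3 → Fin 4 → ℂ) (g : S3 → ℂ) (p : S3) :
    lieD (fun q => c q • V q) g p = c p * lieD V g p := by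
  simp [lieD, Finset.mul_sum, mul_assoc]

theorem lieD_frameZ (g : S3 → ℂ) (p : S3) :
    lieD (frameZ α β) g p
      = α * lieD (linField matU) g p - Complex.I * β * lieD (linField matV) g p := by
  simp [lieD, frameZ, Finset.mul_sum, sub_mul, Finset.sum_sub_distrib, mul_assoc]

theorem lieD_frameZbar (g : S3 → ℂ) (p : S3) :
    lieD (frameZbar α β) g p
      = α * lieD (linField matU) g p + Complex.I * β * lieD (linField matV) g p := by
  simp [lieD, frameZbar, Finset.mul_sum, add_mul, Finset.sum_add_distrib, mul_assoc]

theorem coframe_dot (p : S3) (V : Fin 4 → ℂ) :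
    coframe α β p ⬝ᵥ V
      = 4 * β * (linField matU p ⬝ᵥ V) + 4 * Complex.I * α * (linField matV p ⬝ᵥ V) := by
  simp [coframe]

theorem coframeBar_dot (p : S3) (V : Fin 4 → ℂ) :
    coframeBar α β p ⬝ᵥ V
      = 4 * β * (linField matU p ⬝ᵥ V) - 4 * Complex.I * α * (linField matV p ⬝ᵥ V) := by
  simp [coframeBar]

theorem smooth_smul {c : S3 → ℂ} {V : S3 → Fin 4 → ℂ} (hc : Smooth c) (hV : Smooth V) :
    Smooth (fun q => c q • V q) :=
  smooth_pi.2 fun i => hc.mul' (smooth_pi.1 hV i)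

theorem smooth_frameZ : Smooth (frameZ α β) :=
  ContMDiff.sub (smooth_smul (smooth_const _) (smooth_linField _))
    (smooth_smul (smooth_const _) (smooth_linField _))

theorem smooth_frameZbar : Smooth (frameZbar α β) :=
  ContMDiff.add (smooth_smul (smooth_const _) (smooth_linField _))
    (smooth_smul (smooth_const _) (smooth_linField _))

theorem smooth_coframe : Smooth (coframe α β) :=
  ContMDiff.add (smooth_smul (smooth_const _) (smooth_linField _))
    (smooth_smul (smooth_const _) (smooth_linField _))

theorem smooth_coframeBar : Smooth (coframeBar α β) :=
  ContMDiff.sub (smooth_smul (smooth_const _) (smooth_linField _))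
    (smooth_smul (smooth_const _) (smooth_linField _))

/-- The orthonormality relations of the frame, for the bilinear extension of the scalar product. -/
theorem linField_dot (p : S3) :
    linField mulI p ⬝ᵥ linField mulI p = 1 ∧ linField matU p ⬝ᵥ linField matU p = 1
      ∧ linField matV p ⬝ᵥ linField matV p = 1 ∧ linField mulI p ⬝ᵥ linField matU p = 0
      ∧ linField mulI p ⬝ᵥ linField matV p = 0 ∧ linField matU p ⬝ᵥ linField matV p = 0
      ∧ linField matU p ⬝ᵥ linField mulI p = 0 ∧ linField matV p ⬝ᵥ linField mulI p = 0
      ∧ linField matV p ⬝ᵥ linField matU p = 0 := by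
  have h := pos_norm_complex p
  simp only [linField_mulI, linField_matU, linField_matV, dotProduct, Fin.sum_univ_four,
    Matrix.cons_val]
  refine ⟨?_, ?_, ?_, ?_, ?_, ?_, ?_, ?_, ?_⟩ <;> grind

theorem ctangent_linField {M : Matrix (Fin 4) (Fin 4) ℝ} {p : S3} (hM : Tangent p (M *ᵥ pos p)) :
    CTangent p (linField M p) := by
  simp only [Tangent, dotProduct] at hM
  simp only [CTangent, dotProduct, linField, cplx]
  exact_mod_cast hM

theorem CTangent.add {p : S3} {V W : Fin 4 → ℂ} (hV : CTangent p V) (hW : CTangent p W) :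
    CTangent p (V + W) := by
  simp only [CTangent] at *
  simp [hV, hW]

theorem CTangent.smul {p : S3} {V : Fin 4 → ℂ} (hV : CTangent p V) (c : ℂ) :
    CTangent p (c • V) := by
  simp only [CTangent] at *
  simp [hV]

/-- The differential of a function in terms of the frame. -/
theorem lieD_of_ctangent {p : S3} {V : Fin 4 → ℂ} (hV : CTangent p V) (g : S3 → ℂ) :
    lieD (fun _ => V) g p = (linField mulI p ⬝ᵥ V) * lieD (linField mulI) g p
      + (linField matU p ⬝ᵥ V) * lieD (linField matU) g p
      + (linField matV p ⬝ᵥ V) * lieD (linField matV) g p := by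
  conv_lhs => rw [eq_sum_linField hV]
  simp [lieD, Finset.mul_sum, add_mul, Finset.sum_add_distrib, mul_assoc]

/-- The bracket relation `[U, V] = -2 R`, where `R` is the field of multiplication by `i`. -/
theorem lieD_matU_matV_comm {g : S3 → ℂ} (hg : Smooth g) (p : S3) :
    lieD (linField matU) (lieD (linField matV) g) p - lieD (linField matV) (lieD (linField matU) g) p
      = -2 * lieD (linField mulI) g p := by
  have h : matV * matU - matU * matV = (-2 : ℝ) • mulI := by
    ext i j
    fin_cases i <;> fin_cases j <;>
      norm_num [matU, matV, mulI, Matrix.mul_apply, Fin.sum_univ_four]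
  have e : linField ((-2 : ℝ) • mulI) = fun q => (-2 : ℂ) • linField mulI q := by
    funext q i
    simp [linField, cplx, Matrix.smul_mulVec, Matrix.neg_mulVec]
  rw [lieD_linField_comm tangent_matU tangent_matV hg, h, e, lieD_smul_field (fun _ => -2)]

/-- The bracket relation `[Z, Z̄] = -i T`, where `T = R / 2` is the Reeb field. -/
theorem lieD_frameZ_frameZbar_comm (h : 8 * α * β = 1) {g : S3 → ℂ} (hg : Smooth g) (p : S3) :
    lieD (frameZ α β) (lieD (frameZbar α β) g) p - lieD (frameZbar α β) (lieD (frameZ α β) g) p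
      = -Complex.I / 2 * lieD (linField mulI) g p := by
  have hU : Smooth (lieD (linField matU) g) := (smooth_linField matU).lieD hg
  have hV : Smooth (lieD (linField matV) g) := (smooth_linField matV).lieD hg
  have e1 : lieD (frameZbar α β) g = fun q =>
      α * lieD (linField matU) g q + Complex.I * β * lieD (linField matV) g q :=
    funext fun q => lieD_frameZbar g q
  have e2 : lieD (frameZ α β) g = fun q =>
      α * lieD (linField matU) g q + (-(Complex.I * β)) * lieD (linField matV) g q :=
    funext fun q => by rw [lieD_frameZ]; ring
  have h' : 8 * (α : ℂ) * β = 1 := by exact_mod_cast h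
  have key := lieD_matU_matV_comm hg p
  have s (c : ℂ) {k : S3 → ℂ} (hk : Smooth k) : Smooth (fun q => c * k q) := (smooth_const c).mul' hk
  rw [lieD_frameZ, lieD_frameZbar, e1, e2, lieD_add (s _ hU) (s _ hV), lieD_add (s _ hU) (s _ hV),
    lieD_add (s _ hU) (s _ hV), lieD_add (s _ hU) (s _ hV), lieD_const_mul _ hU,
    lieD_const_mul _ hU, lieD_const_mul _ hV, lieD_const_mul _ hV, lieD_const_mul _ hV,
    lieD_const_mul _ hV]
  linear_combination 2 * Complex.I * α * β * key
    - Complex.I / 2 * lieD (linField mulI) g p * h'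

theorem conj_lieD_linField (hf : Smooth f) (M : Matrix (Fin 4) (Fin 4) ℝ) (p : S3) :
    (starRingEnd ℂ) (lieD (linField M) (fun q => (f q : ℂ)) p)
      = lieD (linField M) (fun q => (f q : ℂ)) p := by
  rw [← lieD_conj hf.ofReal]
  simp [bar_linField]

theorem conj_lieD_frameZ {g : S3 → ℂ} (hg : Smooth g) (p : S3) :
    (starRingEnd ℂ) (lieD (frameZ α β) g p)
      = lieD (frameZbar α β) (fun q => (starRingEnd ℂ) (g q)) p := by
  rw [← lieD_conj hg]
  simp [bar_frameZ]

theorem conj_lieD_frameZbar {g : S3 → ℂ} (hg : Smooth g) (p : S3) :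
    (starRingEnd ℂ) (lieD (frameZbar α β) g p)
      = lieD (frameZ α β) (fun q => (starRingEnd ℂ) (g q)) p := by
  rw [← lieD_conj hg]
  congr 1
  funext q
  rw [← bar_frameZ]
  funext i
  simp [bar]

end Frames

section Conformal

variable {α β : ℝ} {f : S3 → ℝ}

theorem cplx_stdContact (p : S3) : cplx (stdContact p) = (2 : ℂ) • linField mulI p := by
  funext i
  fin_cases i <;> simp [cplx, stdContact, linField_mulI]

theorem cplx_conformalContact (f : S3 → ℝ) (p : S3) :
    cplx (conformalContact f p) = (2 * Complex.exp (2 * (f p : ℂ))) • linField mulI p := by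
  have h := cplx_stdContact p
  funext i
  have hi := congrFun h i
  simp only [cplx, Pi.smul_apply, smul_eq_mul] at hi
  simp only [cplx, conformalContact, Pi.smul_apply, smul_eq_mul, Complex.ofReal_mul, hi]
  push_cast
  ring

/-- The derivative `f_{,1}` of the logarithm of the conformal factor. -/
noncomputable def confD (α β : ℝ) (f : S3 → ℝ) : S3 → ℂ := lieD (frameZ α β) (fun q => (f q : ℂ))

/-- The derivative `f_{,1̄}` of the logarithm of the conformal factor. -/
noncomputable def confDbar (α β : ℝ) (f : S3 → ℝ) : S3 → ℂ :=
  lieD (frameZbar α β) (fun q => (f q : ℂ))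

theorem smooth_confD (hf : Smooth f) : Smooth (confD α β f) := smooth_frameZ.lieD hf.ofReal

theorem smooth_confDbar (hf : Smooth f) : Smooth (confDbar α β f) := smooth_frameZbar.lieD hf.ofReal

theorem conj_confD (hf : Smooth f) (p : S3) :
    (starRingEnd ℂ) (confD α β f p) = confDbar α β f p := by
  rw [confD, conj_lieD_frameZ hf.ofReal]
  simp [confDbar]

theorem conj_confDbar (hf : Smooth f) (p : S3) :
    (starRingEnd ℂ) (confDbar α β f p) = confD α β f p := by
  rw [confDbar, conj_lieD_frameZbar hf.ofReal]
  simp [confD]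

/-- The form `e^f (θ¹ + 2 i f_{,1̄} θ)`, which completes `e^{2f} θ` to a unitary coframe. -/
noncomputable def confCoframe (α β : ℝ) (f : S3 → ℝ) (p : S3) : Fin 4 → ℂ :=
  Complex.exp (f p) • coframe α β p
    + (4 * Complex.I * (Complex.exp (f p) * confDbar α β f p)) • linField mulI p

theorem confCoframe_dot (p : S3) (V : Fin 4 → ℂ) :
    confCoframe α β f p ⬝ᵥ V = Complex.exp (f p)
      * (4 * β * (linField matU p ⬝ᵥ V) + 4 * Complex.I * α * (linField matV p ⬝ᵥ V)
        + 4 * Complex.I * confDbar α β f p * (linField mulI p ⬝ᵥ V)) := by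
  simp [confCoframe, coframe_dot]
  ring

theorem bar_confCoframe_dot (hf : Smooth f) (p : S3) (V : Fin 4 → ℂ) :
    bar (confCoframe α β f p) ⬝ᵥ V = Complex.exp (f p)
      * (4 * β * (linField matU p ⬝ᵥ V) - 4 * Complex.I * α * (linField matV p ⬝ᵥ V)
        - 4 * Complex.I * confD α β f p * (linField mulI p ⬝ᵥ V)) := by
  simp [confCoframe, bar_add, bar_smul, bar_coframe, bar_linField, coframeBar_dot,
    conj_confDbar hf, ← Complex.exp_conj, map_ofNat]
  ring

theorem exp_two_mul (z : ℂ) : Complex.exp (2 * z) = Complex.exp z ^ 2 := by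
  rw [← Complex.exp_nat_mul]
  norm_num

theorem smooth_exp_mul (c : ℂ) (hf : Smooth f) : Smooth (fun q => Complex.exp (c * (f q : ℂ))) :=
  ((smooth_const c).mul' hf.ofReal).cexp

/-- The structure equation `dθ = i θ¹ ∧ θ^{1̄}` for the contact form `e^{2f} θ`. -/
theorem dForm_conformalContact (h : 8 * α * β = 1) (hf : Smooth f) {p : S3} {V W : Fin 4 → ℂ}
    (hV : CTangent p V) (hW : CTangent p W) :
    dForm (fun q => cplx (conformalContact f q)) p V W
      = Complex.I * ((confCoframe α β f p ⬝ᵥ V) * (bar (confCoframe α β f p) ⬝ᵥ W)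
        - (confCoframe α β f p ⬝ᵥ W) * (bar (confCoframe α β f p) ⬝ᵥ V)) := by
  have h' : 8 * (α : ℂ) * β = 1 := by exact_mod_cast h
  have e : (fun q => cplx (conformalContact f q))
      = fun q => (2 * Complex.exp (2 * (f q : ℂ))) • linField mulI q :=
    funext fun q => cplx_conformalContact f q
  have hs := smooth_exp_mul 2 hf
  rw [e, dForm_smul ((smooth_const 2).mul' hs) (smooth_linField _), dForm_mulI hV hW,
    lieD_const_mul _ hs, lieD_const_mul _ hs, lieD_cexp ((smooth_const 2).mul' hf.ofReal),
    lieD_cexp ((smooth_const 2).mul' hf.ofReal), lieD_const_mul _ hf.ofReal,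
    lieD_const_mul _ hf.ofReal, lieD_of_ctangent hV, lieD_of_ctangent hW]
  simp only [confCoframe_dot, bar_confCoframe_dot hf]
  rw [confD, confDbar, lieD_frameZ, lieD_frameZbar, exp_two_mul]
  generalize linField mulI p ⬝ᵥ V = r
  generalize linField matU p ⬝ᵥ V = u
  generalize linField matV p ⬝ᵥ V = v
  generalize linField mulI p ⬝ᵥ W = r'
  generalize linField matU p ⬝ᵥ W = u'
  generalize linField matV p ⬝ᵥ W = v'
  generalize lieD (linField mulI) (fun q => (f q : ℂ)) p = fR
  generalize lieD (linField matU) (fun q => (f q : ℂ)) p = fU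
  generalize lieD (linField matV) (fun q => (f q : ℂ)) p = fV
  generalize Complex.exp (f p : ℂ) = E
  have hI : Complex.I ^ 2 = -1 := Complex.I_sq
  grind

end Conformal

section UnitaryFrames

variable {α β : ℝ} {f : S3 → ℝ}

/-- The coefficient of the standard contact form `θ` in the connection form of `e^{2f} θ`, written in
the coframe `θ, θ¹, θ^{1̄}` of the standard contact form. Its values are imaginary by construction;
the commutator of `Z` and `Z̄` on `f` turns it into the coefficient in the structure equation. -/
noncomputable def confConnT (α β : ℝ) (f : S3 → ℝ) (p : S3) : ℂ :=
  Complex.I * (8 * (confD α β f p * confDbar α β f p) + (-4 * (α ^ 2 + β ^ 2))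
    + (lieD (frameZ α β) (confDbar α β f) p + lieD (frameZbar α β) (confD α β f) p))

/-- The connection form of `e^{2f} θ` in the unitary frame `e^{-f} (α U - i β V)`. -/
noncomputable def confConn (α β : ℝ) (f : S3 → ℝ) (p : S3) : Fin 4 → ℂ :=
  (3 * confD α β f p) • coframe α β p + (-3 * confDbar α β f p) • coframeBar α β p
    + (2 * confConnT α β f p) • linField mulI p

/-- The torsion coefficient of `e^{2f} θ` in the unitary frame `e^{-f} (α U - i β V)`. -/
noncomputable def confTorsion (α β : ℝ) (f : S3 → ℝ) (p : S3) : ℂ :=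
  Complex.exp (-2 * (f p : ℂ)) * (-4 * Complex.I * (β ^ 2 - α ^ 2)
    + 4 * Complex.I * (confDbar α β f p * confDbar α β f p)
    + (-2 * Complex.I) * lieD (frameZbar α β) (confDbar α β f) p)

theorem confConn_dot (p : S3) (V : Fin 4 → ℂ) :
    confConn α β f p ⬝ᵥ V
      = 3 * confD α β f p * (4 * β * (linField matU p ⬝ᵥ V)
          + 4 * Complex.I * α * (linField matV p ⬝ᵥ V))
        - 3 * confDbar α β f p * (4 * β * (linField matU p ⬝ᵥ V)
          - 4 * Complex.I * α * (linField matV p ⬝ᵥ V))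
        + 2 * confConnT α β f p * (linField mulI p ⬝ᵥ V) := by
  simp [confConn, coframe_dot, coframeBar_dot]
  ring

theorem conj_confConnT (hf : Smooth f) (p : S3) :
    (starRingEnd ℂ) (confConnT α β f p) = -confConnT α β f p := by
  simp only [confConnT, map_mul, map_add, map_neg, map_ofNat, map_pow, Complex.conj_I,
    Complex.conj_ofReal, conj_confD hf, conj_confDbar hf, conj_lieD_frameZ (smooth_confDbar hf),
    conj_lieD_frameZbar (smooth_confD hf)]
  ring

theorem bar_confConn_dot (hf : Smooth f) (p : S3) (V : Fin 4 → ℂ) :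
    bar (confConn α β f p) ⬝ᵥ V = -(confConn α β f p ⬝ᵥ V) := by
  simp only [confConn, bar_add, bar_smul, bar_coframe, bar_coframeBar, bar_linField, map_mul,
    map_neg, map_ofNat, conj_confD hf, conj_confDbar hf, conj_confConnT hf, add_dotProduct,
    smul_dotProduct, smul_eq_mul]
  ring

/-- The structure equation `dθ¹ = θ¹ ∧ ω₁¹ + A θ ∧ θ^{1̄}` for the contact form `e^{2f} θ`. -/
theorem dForm_confCoframe (h : 8 * α * β = 1) (hf : Smooth f) {p : S3} {V W : Fin 4 → ℂ}
    (hV : CTangent p V) (hW : CTangent p W) :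
    dForm (confCoframe α β f) p V W
      = ((confCoframe α β f p ⬝ᵥ V) * (confConn α β f p ⬝ᵥ W)
          - (confCoframe α β f p ⬝ᵥ W) * (confConn α β f p ⬝ᵥ V))
        + confTorsion α β f p * ((cplx (conformalContact f p) ⬝ᵥ V)
          * (bar (confCoframe α β f p) ⬝ᵥ W)
          - (cplx (conformalContact f p) ⬝ᵥ W) * (bar (confCoframe α β f p) ⬝ᵥ V)) := by
  have h' : 8 * (α : ℂ) * β = 1 := by exact_mod_cast h
  have hE := hf.ofReal.cexp
  have hb := smooth_confDbar (α := α) (β := β) hf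
  have e : dForm (confCoframe α β f) p V W
      = dForm (fun q => Complex.exp (f q) • coframe α β q
          + (4 * Complex.I * (Complex.exp (f q) * confDbar α β f q)) • linField mulI q) p V W := rfl
  have e2 : dForm (coframe α β) p V W
      = 4 * β * dForm (linField matU) p V W + 4 * Complex.I * α * dForm (linField matV) p V W := by
    rw [← dForm_const_smul _ (smooth_linField _), ← dForm_const_smul _ (smooth_linField _)]
    exact dForm_add (smooth_smul (smooth_const _) (smooth_linField _))
      (smooth_smul (smooth_const _) (smooth_linField _)) p V W
  have comm := lieD_frameZ_frameZbar_comm h hf.ofReal p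
  rw [e, dForm_add (smooth_smul hE smooth_coframe)
    (smooth_smul ((smooth_const _).mul' (hE.mul' hb)) (smooth_linField _)),
    dForm_smul hE smooth_coframe,
    dForm_smul ((smooth_const _).mul' (hE.mul' hb)) (smooth_linField _), e2, dForm_mulI hV hW,
    dForm_matU hV hW, dForm_matV hV hW, lieD_const_mul _ (hE.mul' hb),
    lieD_const_mul _ (hE.mul' hb), lieD_mul hE hb, lieD_mul hE hb, lieD_cexp hf.ofReal,
    lieD_cexp hf.ofReal, lieD_of_ctangent hV (confDbar α β f), lieD_of_ctangent hW (confDbar α β f),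
    lieD_of_ctangent hV, lieD_of_ctangent hW, cplx_conformalContact]
  simp only [confCoframe_dot, bar_confCoframe_dot hf, confConn_dot, smul_dotProduct, smul_eq_mul,
    coframe_dot, confTorsion, confConnT]
  have comm' : lieD (frameZbar α β) (confD α β f) p
      = lieD (frameZ α β) (confDbar α β f) p
        + Complex.I / 2 * lieD (linField mulI) (fun q => (f q : ℂ)) p := by
    simp only [confD, confDbar]
    linear_combination -comm
  have hexp : Complex.exp (-2 * (f p : ℂ)) * Complex.exp (2 * (f p : ℂ)) = 1 := by
    rw [← Complex.exp_add]
    simp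
  have hbU : lieD (linField matU) (confDbar α β f) p = 4 * β * (lieD (frameZ α β) (confDbar α β f) p
      + lieD (frameZbar α β) (confDbar α β f) p) := by
    rw [lieD_frameZ, lieD_frameZbar]
    linear_combination -lieD (linField matU) (confDbar α β f) p * h'
  have hbV : lieD (linField matV) (confDbar α β f) p = 4 * Complex.I * α
      * (lieD (frameZ α β) (confDbar α β f) p - lieD (frameZbar α β) (confDbar α β f) p) := by
    rw [lieD_frameZ, lieD_frameZbar]
    linear_combination -lieD (linField matV) (confDbar α β f) p * h'
      + 8 * α * β * lieD (linField matV) (confDbar α β f) p * Complex.I_sq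
  have hfU : lieD (linField matU) (fun q => (f q : ℂ)) p
      = 4 * β * (confD α β f p + confDbar α β f p) := by
    rw [confD, confDbar, lieD_frameZ, lieD_frameZbar]
    linear_combination -lieD (linField matU) (fun q => (f q : ℂ)) p * h'
  have hfV : lieD (linField matV) (fun q => (f q : ℂ)) p
      = 4 * Complex.I * α * (confD α β f p - confDbar α β f p) := by
    rw [confD, confDbar, lieD_frameZ, lieD_frameZbar]
    linear_combination -lieD (linField matV) (fun q => (f q : ℂ)) p * h'
      + 8 * α * β * lieD (linField matV) (fun q => (f q : ℂ)) p * Complex.I_sq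
  rw [comm', hbU, hbV, hfU, hfV]
  generalize linField mulI p ⬝ᵥ V = r
  generalize linField matU p ⬝ᵥ V = u
  generalize linField matV p ⬝ᵥ V = v
  generalize linField mulI p ⬝ᵥ W = r'
  generalize linField matU p ⬝ᵥ W = u'
  generalize linField matV p ⬝ᵥ W = v'
  generalize lieD (linField mulI) (fun q => (f q : ℂ)) p = fR
  generalize lieD (linField mulI) (confDbar α β f) p = bR
  generalize lieD (frameZ α β) (confDbar α β f) p = x
  generalize lieD (frameZbar α β) (confDbar α β f) p = y
  generalize confD α β f p = b
  generalize confDbar α β f p = c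
  generalize Complex.exp (f p : ℂ) = E
  generalize Complex.exp (2 * (f p : ℂ)) = E2 at *
  generalize Complex.exp (-2 * (f p : ℂ)) = E3 at *
  have hI : Complex.I ^ 2 = -1 := Complex.I_sq
  generalize Complex.I = I at *
  linear_combination (-(-4 * I * (β ^ 2 - α ^ 2) + 4 * I * (c * c) + -2 * I * y)
    * (2 * r * E * (4 * β * u' - 4 * I * α * v' - 4 * I * b * r')
      - 2 * r' * E * (4 * β * u - 4 * I * α * v - 4 * I * b * r))) * hexp
    - 8 * E * (I * α * (r * u' - u * r') + β * I ^ 2 * (r * v' - v * r')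
      + c * I * (u * v' - v * u')) * h'
    + 4 * E * (fR * β * (r * u' - u * r') + fR * I * α * (r * v' - v * r')
      - 2 * β * (r * v' - v * r')) * hI

/-- The Reeb field `e^{-2f} (T + (V f) U / 2 - (U f) V / 2)` of `e^{2f} θ`, with `T = R / 2` the Reeb
field of the standard contact form. The derivatives of `f` are real; `re` only changes their type. -/
noncomputable def confReeb (f : S3 → ℝ) (p : S3) : Fin 4 → ℝ :=
  (Real.exp (-2 * f p) / 2) • (mulI *ᵥ pos p
    + (lieD (linField matV) (fun q => (f q : ℂ)) p).re • (matU *ᵥ pos p)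
    + (-(lieD (linField matU) (fun q => (f q : ℂ)) p).re) • (matV *ᵥ pos p))

theorem cplx_confReeb (hf : Smooth f) (p : S3) :
    cplx (confReeb f p) = (Complex.exp (-2 * (f p : ℂ)) / 2) • (linField mulI p
      + lieD (linField matV) (fun q => (f q : ℂ)) p • linField matU p
      + (-lieD (linField matU) (fun q => (f q : ℂ)) p) • linField matV p) := by
  have h1 := Complex.conj_eq_iff_re.1 (conj_lieD_linField hf matU p)
  have h2 := Complex.conj_eq_iff_re.1 (conj_lieD_linField hf matV p)
  funext i
  simp [cplx, confReeb, linField, h1, h2]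

theorem linField_dot_confReeb (hf : Smooth f) (p : S3) :
    linField mulI p ⬝ᵥ cplx (confReeb f p) = Complex.exp (-2 * (f p : ℂ)) / 2
      ∧ linField matU p ⬝ᵥ cplx (confReeb f p) = Complex.exp (-2 * (f p : ℂ)) / 2
        * lieD (linField matV) (fun q => (f q : ℂ)) p
      ∧ linField matV p ⬝ᵥ cplx (confReeb f p) = -(Complex.exp (-2 * (f p : ℂ)) / 2
        * lieD (linField matU) (fun q => (f q : ℂ)) p) := by
  obtain ⟨h1, h2, h3, h4, h5, h6, h7, h8, h9⟩ := linField_dot p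
  rw [cplx_confReeb hf]
  simp [h1, h2, h3, h4, h5, h6, h7, h8, h9]

theorem smooth_confReeb (hf : Smooth f) : Smooth (confReeb f) := by
  have h (M : Matrix (Fin 4) (Fin 4) ℝ) : Smooth (lieD (linField M) (fun q => (f q : ℂ))) :=
    (smooth_linField M).lieD hf.ofReal
  have s (M : Matrix (Fin 4) (Fin 4) ℝ) (i : Fin 4) := smooth_pi.1 (smooth_mulVec M) i
  have he : Smooth (fun q => Real.exp (-2 * f q) / 2) := by
    simp only [div_eq_mul_inv]
    exact (((smooth_const (-2 : ℝ)).mul' hf).rexp).mul' (smooth_const _)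
  refine smooth_pi.2 fun i => ?_
  exact he.mul' (((s mulI i).add' ((h matV).re.mul' (s matU i))).add'
    (Smooth.mul' (ContMDiff.neg (h matU).re) (s matV i)))

theorem tangent_confReeb (p : S3) : Tangent p (confReeb f p) := by
  have h1 := tangent_mulI p
  have h2 := tangent_matU p
  have h3 := tangent_matV p
  simp only [Tangent] at *
  simp [confReeb, h1, h2, h3]

theorem confCoframe_dot_confReeb (hf : Smooth f) (p : S3) :
    confCoframe α β f p ⬝ᵥ cplx (confReeb f p) = 0 := by
  obtain ⟨h1, h2, h3⟩ := linField_dot_confReeb hf p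
  rw [confCoframe_dot, h1, h2, h3, confDbar, lieD_frameZbar]
  linear_combination (-2 * Complex.exp (f p) * Complex.exp (-2 * (f p : ℂ)) * β
    * lieD (linField matV) (fun q => (f q : ℂ)) p) * -Complex.I_sq

theorem bar_dot_cplx (V : Fin 4 → ℂ) (X : Fin 4 → ℝ) :
    bar V ⬝ᵥ cplx X = (starRingEnd ℂ) (V ⬝ᵥ cplx X) := by
  simp [bar, cplx, dotProduct]

theorem smooth_stdContact : Smooth stdContact := by
  refine smooth_pi.2 fun i => ?_
  have h (c : ℝ) (k : Fin 4) : Smooth (fun p : S3 => c * pos p k) :=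
    (smooth_const c).mul' (smooth_pos k)
  fin_cases i
  exacts [h _ 1, h _ 0, h _ 3, h _ 2]

theorem smooth_conformalContact (hf : Smooth f) : Smooth (conformalContact f) :=
  smooth_pi.2 fun i => ((smooth_const (2 : ℝ)).mul' hf).rexp.mul' (smooth_pi.1 smooth_stdContact i)

theorem linField_dot_frameZ (p : S3) :
    linField mulI p ⬝ᵥ frameZ α β p = 0 ∧ linField matU p ⬝ᵥ frameZ α β p = α
      ∧ linField matV p ⬝ᵥ frameZ α β p = -(Complex.I * β) := by
  obtain ⟨h1, h2, h3, h4, h5, h6, h7, h8, h9⟩ := linField_dot p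
  simp [frameZ, h2, h3, h4, h5, h6, h9, -Complex.coe_smul]

theorem linField_dot_frameZbar (p : S3) :
    linField mulI p ⬝ᵥ frameZbar α β p = 0 ∧ linField matU p ⬝ᵥ frameZbar α β p = α
      ∧ linField matV p ⬝ᵥ frameZbar α β p = Complex.I * β := by
  obtain ⟨h1, h2, h3, h4, h5, h6, h7, h8, h9⟩ := linField_dot p
  simp [frameZbar, h2, h3, h4, h5, h6, h9, -Complex.coe_smul]

theorem ctangent_frameZ (p : S3) : CTangent p (frameZ α β p) := by
  rw [frameZ, sub_eq_add_neg, ← neg_smul]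
  exact ((ctangent_linField (tangent_matU p)).smul _).add
    ((ctangent_linField (tangent_matV p)).smul _)

theorem map_mulVec_linField (J M : Matrix (Fin 4) (Fin 4) ℝ) (p : S3) :
    J.map Complex.ofReal *ᵥ linField M p = cplx (J *ᵥ (M *ᵥ pos p)) := by
  funext i
  simp [linField, cplx, Matrix.mulVec, dotProduct]

theorem invariantJ_mulVec_frameZ (h : 8 * α * β = 1) (p : S3) :
    (invariantJ α β p).map Complex.ofReal *ᵥ frameZ α β p = Complex.I • frameZ α β p := by
  have h' : 8 * (α : ℂ) * β = 1 := by exact_mod_cast h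
  have e : (matV *ᵥ pos p) ⬝ᵥ (matU *ᵥ pos p) = 0 := by rw [dotProduct_comm, matU_dot_matV]
  rw [frameZ, Matrix.mulVec_sub, Matrix.mulVec_smul, Matrix.mulVec_smul, map_mulVec_linField,
    map_mulVec_linField, invariantJ_mulVec, invariantJ_mulVec, matU_dot_matU, matV_dot_matV,
    matU_dot_matV, e]
  funext i
  simp [cplx, linField, -Complex.coe_smul]
  linear_combination (Complex.I * α * ((matU *ᵥ pos p) i : ℂ) + β * ((matV *ᵥ pos p) i : ℂ)) * h'
    + β * ((matV *ᵥ pos p) i : ℂ) * Complex.I_sq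

theorem exp_mul_exp_neg (z : ℂ) : Complex.exp z * Complex.exp (-z) = 1 := by
  rw [← Complex.exp_add]
  simp

/-- The unitary frame for the contact form `e^{2f} θ` and the CR structure `invariantCR α β` with
`Z₁ = e^{-f} (α U - i β V)`. -/
noncomputable def confFrame (h : 8 * α * β = 1) (hf : Smooth f) :
    UnitaryFrame (invariantCR α β h) (conformalContact f) where
  T := confReeb f
  Z p := Complex.exp (-(f p : ℂ)) • frameZ α β p
  θ1 := confCoframe α β f
  conn := confConn α β f
  A := confTorsion α β f
  smooth_T := smooth_confReeb hf
  smooth_Z := by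
    have := smooth_exp_mul (-1) hf
    simp only [neg_one_mul] at this
    exact smooth_smul this smooth_frameZ
  smooth_θ1 := ContMDiff.add (smooth_smul hf.ofReal.cexp smooth_coframe)
    (smooth_smul ((smooth_const _).mul' (hf.ofReal.cexp.mul' (smooth_confDbar hf)))
      (smooth_linField _))
  smooth_conn := by
    have hb := smooth_confD (α := α) (β := β) hf
    have hc := smooth_confDbar (α := α) (β := β) hf
    have hT : Smooth (confConnT α β f) := (smooth_const _).mul'
      ((((smooth_const _).mul' (hb.mul' hc)).add' (smooth_const _)).add'
        ((smooth_frameZ.lieD hc).add' (smooth_frameZbar.lieD hb)))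
    exact ((smooth_smul ((smooth_const _).mul' hb) smooth_coframe).add'
      (smooth_smul ((smooth_const _).mul' hc) smooth_coframeBar)).add'
      (smooth_smul ((smooth_const _).mul' hT) (smooth_linField _))
  smooth_A := by
    have hc := smooth_confDbar (α := α) (β := β) hf
    exact (smooth_exp_mul (-2) hf).mul' (((smooth_const _).add'
      ((smooth_const _).mul' (hc.mul' hc))).add' ((smooth_const _).mul' (smooth_frameZbar.lieD hc)))
  tangent_T := tangent_confReeb
  θ_T p := by
    have h1 : cplx (conformalContact f p) ⬝ᵥ cplx (confReeb f p) = 1 := by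
      rw [cplx_conformalContact, smul_dotProduct, (linField_dot_confReeb hf p).1, smul_eq_mul]
      have := exp_mul_exp_neg (2 * (f p : ℂ))
      rw [neg_mul]
      linear_combination this
    simp only [dotProduct, cplx] at h1
    exact_mod_cast h1
  dθ_T p V hV := by
    have hT := tangent_confReeb (f := f) p
    have hc {X : Fin 4 → ℝ} (hX : Tangent p X) : CTangent p (cplx X) := by
      simp only [Tangent, dotProduct] at hX
      simp only [CTangent, dotProduct, cplx]
      exact_mod_cast hX
    have h1 := dForm_conformalContact h hf (hc hT) (hc hV)
    rw [dForm_ofReal (smooth_conformalContact hf), bar_dot_cplx _ (confReeb f p),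
      confCoframe_dot_confReeb hf] at h1
    simpa using h1
  tangent_Z p := (ctangent_frameZ p).smul _
  θ_Z p := by
    rw [cplx_conformalContact, smul_dotProduct, dotProduct_smul, (linField_dot_frameZ p).1]
    simp
  J_Z p := by
    rw [Matrix.mulVec_smul, smul_comm]
    congr 1
    exact invariantJ_mulVec_frameZ h p
  θ1_T := confCoframe_dot_confReeb hf
  θ1_Z p := by
    have h' : 8 * (α : ℂ) * β = 1 := by exact_mod_cast h
    obtain ⟨h1, h2, h3⟩ := linField_dot_frameZ (α := α) (β := β) p
    rw [dotProduct_smul, confCoframe_dot, h1, h2, h3, smul_eq_mul]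
    have := exp_mul_exp_neg (f p : ℂ)
    linear_combination 8 * α * β * this + h' - 4 * α * β * Complex.exp (f p)
      * Complex.exp (-(f p : ℂ)) * Complex.I_sq
  θ1_Zbar p := by
    obtain ⟨h1, h2, h3⟩ := linField_dot_frameZbar (α := α) (β := β) p
    rw [bar_smul, bar_frameZ, dotProduct_smul, confCoframe_dot, h1, h2, h3, smul_eq_mul]
    linear_combination 4 * α * β * Complex.exp (f p)
      * (starRingEnd ℂ) (Complex.exp (-(f p : ℂ))) * Complex.I_sq
  dθ_eq _ _ _ := dForm_conformalContact h hf
  conn_skew p V _ := by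
    rw [bar_confConn_dot hf]
    ring
  dθ1_eq _ _ _ := dForm_confCoframe h hf

end UnitaryFrames

/-! ### The Paneitz operator of the invariant structures -/

section Paneitz

variable {α β : ℝ} {f : S3 → ℝ}

theorem lieD_exp_mul {V : S3 → Fin 4 → ℂ} (n : ℂ) (hf : Smooth f) {c : S3 → ℂ} (hc : Smooth c)
    (p : S3) : lieD V (fun q => Complex.exp (n * (f q : ℂ)) * c q) p
      = Complex.exp (n * (f p : ℂ)) * (n * lieD V (fun q => (f q : ℂ)) p * c p + lieD V c p) := by
  rw [lieD_mul (smooth_exp_mul n hf) hc, lieD_cexp ((smooth_const n).mul' hf.ofReal),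
    lieD_const_mul n hf.ofReal]
  ring

theorem confFrame_Z (h : 8 * α * β = 1) (hf : Smooth f) :
    (confFrame h hf).Z = fun p => Complex.exp (-(f p : ℂ)) • frameZ α β p := rfl

theorem confFrame_Zbar (h : 8 * α * β = 1) (hf : Smooth f) :
    (confFrame h hf).Zbar = fun p => Complex.exp (-(f p : ℂ)) • frameZbar α β p := by
  funext p
  simp only [UnitaryFrame.Zbar, confFrame_Z, bar_smul, bar_frameZ, ← Complex.exp_conj, map_neg,
    Complex.conj_ofReal]

theorem confConn_dot_frameZ (h : 8 * α * β = 1) (p : S3) :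
    confConn α β f p ⬝ᵥ frameZ α β p = 3 * confD α β f p := by
  have h' : 8 * (α : ℂ) * β = 1 := by exact_mod_cast h
  obtain ⟨h1, h2, h3⟩ := linField_dot_frameZ (α := α) (β := β) p
  rw [confConn_dot, h1, h2, h3]
  linear_combination 3 * confD α β f p * h'
    - 12 * α * β * (confD α β f p + confDbar α β f p) * Complex.I_sq

theorem confConn_dot_frameZbar (h : 8 * α * β = 1) (p : S3) :
    confConn α β f p ⬝ᵥ frameZbar α β p = -3 * confDbar α β f p := by
  have h' : 8 * (α : ℂ) * β = 1 := by exact_mod_cast h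
  obtain ⟨h1, h2, h3⟩ := linField_dot_frameZbar (α := α) (β := β) p
  rw [confConn_dot, h1, h2, h3]
  linear_combination -3 * confDbar α β f p * h'
    + 12 * α * β * (confD α β f p + confDbar α β f p) * Complex.I_sq

theorem cov1_confFrame (h : 8 * α * β = 1) (hf : Smooth f) (k : ℤ) (c : S3 → ℂ) (p : S3) :
    (confFrame h hf).cov1 k c p
      = Complex.exp (-(f p : ℂ)) * (lieD (frameZ α β) c p - k * (3 * confD α β f p) * c p) := by
  have e : (confFrame h hf).conn p ⬝ᵥ (confFrame h hf).Z p
      = Complex.exp (-(f p : ℂ)) * (3 * confD α β f p) := by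
    rw [confFrame_Z, dotProduct_smul, smul_eq_mul]
    exact congrArg _ (confConn_dot_frameZ h p)
  rw [UnitaryFrame.cov1, e, confFrame_Z, lieD_smul_field]
  ring

theorem covBar_confFrame (h : 8 * α * β = 1) (hf : Smooth f) (k : ℤ) (c : S3 → ℂ) (p : S3) :
    (confFrame h hf).covBar k c p
      = Complex.exp (-(f p : ℂ))
        * (lieD (frameZbar α β) c p - k * (-3 * confDbar α β f p) * c p) := by
  have e : (confFrame h hf).conn p ⬝ᵥ (confFrame h hf).Zbar p
      = Complex.exp (-(f p : ℂ)) * (-3 * confDbar α β f p) := by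
    rw [confFrame_Zbar, dotProduct_smul, smul_eq_mul]
    exact congrArg _ (confConn_dot_frameZbar h p)
  rw [UnitaryFrame.covBar, e, confFrame_Zbar, lieD_smul_field]
  ring

theorem A11_confFrame (h : 8 * α * β = 1) (hf : Smooth f) (p : S3) :
    (confFrame h hf).A11 p = Complex.exp (-2 * (f p : ℂ)) * (4 * Complex.I * (β ^ 2 - α ^ 2)
      - 4 * Complex.I * (confD α β f p * confD α β f p)
      + 2 * Complex.I * lieD (frameZ α β) (confD α β f) p) := by
  have e : (confFrame h hf).A11 p = (starRingEnd ℂ) (confTorsion α β f p) := rfl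
  simp only [e, confTorsion, map_mul, map_add, map_sub, map_neg, map_ofNat, map_pow, Complex.conj_I,
    Complex.conj_ofReal, conj_confDbar hf, conj_lieD_frameZbar (smooth_confDbar hf),
    ← Complex.exp_conj]
  ring

/-- The conformal covariance of the third order operator: the terms involving the conformal
factor cancel, apart from the power of the factor. -/
theorem P3_confFrame (h : 8 * α * β = 1) (hf : Smooth f) {φ : S3 → ℂ} (hφ : Smooth φ) (p : S3) :
    (confFrame h hf).P3 φ p = Complex.exp (-3 * (f p : ℂ))
      * (lieD (frameZ α β) (lieD (frameZ α β) (lieD (frameZbar α β) φ)) p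
        - 4 * (β ^ 2 - α ^ 2) * lieD (frameZbar α β) φ p) := by
  have hb := smooth_confD (α := α) (β := β) hf
  have hψ : Smooth (lieD (frameZbar α β) φ) := smooth_frameZbar.lieD hφ
  have hψ' : Smooth (lieD (frameZ α β) (lieD (frameZbar α β) φ)) := smooth_frameZ.lieD hψ
  have h1 : (confFrame h hf).covBar 0 φ
      = fun q => Complex.exp (-1 * (f q : ℂ)) * lieD (frameZbar α β) φ q := by
    funext q
    rw [covBar_confFrame, neg_one_mul]
    simp
  have e2 (z : ℂ) : Complex.exp (-2 * z) = Complex.exp (-z) ^ 2 := by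
    rw [← exp_two_mul]
    ring_nf
  have e3 (z : ℂ) : Complex.exp (-3 * z) = Complex.exp (-z) ^ 3 := by
    rw [← Complex.exp_nat_mul]
    ring_nf
  have h2 : (confFrame h hf).cov1 (-1) ((confFrame h hf).covBar 0 φ)
      = fun q => Complex.exp (-2 * (f q : ℂ))
        * (lieD (frameZ α β) (lieD (frameZbar α β) φ) q
          + 2 * (confD α β f q * lieD (frameZbar α β) φ q)) := by
    funext q
    rw [cov1_confFrame, h1, lieD_exp_mul _ hf hψ, e2, ← confD, neg_one_mul]
    push_cast
    ring_nf
  rw [UnitaryFrame.P3, h2, cov1_confFrame, h1, A11_confFrame,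
    lieD_exp_mul _ hf (hψ'.add' ((smooth_const _).mul' (hb.mul' hψ))),
    lieD_add hψ' ((smooth_const _).mul' (hb.mul' hψ)), lieD_const_mul _ (hb.mul' hψ),
    lieD_mul hb hψ, e2, e3, ← confD]
  simp only [neg_one_mul, Int.cast_zero]
  linear_combination Complex.exp (-(f p : ℂ)) ^ 3 * lieD (frameZbar α β) φ p
    * (4 * (β ^ 2 - α ^ 2) - 4 * (confD α β f p * confD α β f p)
      + 2 * lieD (frameZ α β) (confD α β f) p) * Complex.I_sq

theorem lieD_linField_pos {M : Matrix (Fin 4) (Fin 4) ℝ} {p : S3} (hM : Tangent p (M *ᵥ pos p))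
    (k : Fin 4) : lieD (linField M) (fun q => (pos q k : ℂ)) p = linField M p k := by
  let L : R4 →L[ℝ] ℂ := Complex.ofRealCLM ∘L (EuclideanSpace.proj k : R4 →L[ℝ] ℝ)
  exact lieD_linField_restrict hM L L L.hasFDerivAt

theorem lieD_frameZ_linear (a b : ℂ) (i j : Fin 4) (p : S3) :
    lieD (frameZ α β) (fun q => a * (pos q i : ℂ) + b * (pos q j : ℂ)) p
      = α * (a * linField matU p i + b * linField matU p j)
        - Complex.I * β * (a * linField matV p i + b * linField matV p j) := by
  have hs (k : Fin 4) : Smooth (fun q : S3 => (pos q k : ℂ)) := (smooth_pos k).ofReal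
  rw [lieD_add ((smooth_const a).mul' (hs i)) ((smooth_const b).mul' (hs j)),
    lieD_const_mul _ (hs i), lieD_const_mul _ (hs j), lieD_frameZ, lieD_frameZ,
    lieD_linField_pos (tangent_matU p), lieD_linField_pos (tangent_matV p),
    lieD_linField_pos (tangent_matU p), lieD_linField_pos (tangent_matV p)]
  ring

theorem lieD_frameZbar_linear (a b : ℂ) (i j : Fin 4) (p : S3) :
    lieD (frameZbar α β) (fun q => a * (pos q i : ℂ) + b * (pos q j : ℂ)) p
      = α * (a * linField matU p i + b * linField matU p j)
        + Complex.I * β * (a * linField matV p i + b * linField matV p j) := by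
  have hs (k : Fin 4) : Smooth (fun q : S3 => (pos q k : ℂ)) := (smooth_pos k).ofReal
  rw [lieD_add ((smooth_const a).mul' (hs i)) ((smooth_const b).mul' (hs j)),
    lieD_const_mul _ (hs i), lieD_const_mul _ (hs j), lieD_frameZbar, lieD_frameZbar,
    lieD_linField_pos (tangent_matU p), lieD_linField_pos (tangent_matV p),
    lieD_linField_pos (tangent_matU p), lieD_linField_pos (tangent_matV p)]
  ring

theorem lieD_frameZbar_pos :
    lieD (frameZbar α β) (fun q => (pos q 0 : ℂ))
      = fun q => (α : ℂ) * (pos q 2 : ℂ) + Complex.I * β * (pos q 3 : ℂ) := by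
  funext q
  rw [lieD_frameZbar, lieD_linField_pos (tangent_matU q), lieD_linField_pos (tangent_matV q)]
  simp [linField_matU, linField_matV]

theorem lieD_frameZ_frameZ_frameZbar_pos (p : S3) :
    lieD (frameZ α β) (lieD (frameZ α β) (lieD (frameZbar α β) (fun q => (pos q 0 : ℂ)))) p
      = (β ^ 2 - α ^ 2) * lieD (frameZbar α β) (fun q => (pos q 0 : ℂ)) p := by
  have e : lieD (frameZ α β) (lieD (frameZbar α β) (fun q => (pos q 0 : ℂ)))
      = fun q => (-(α ^ 2 + β ^ 2) : ℂ) * (pos q 0 : ℂ)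
        + (2 * Complex.I * α * β) * (pos q 1 : ℂ) := by
    funext q
    rw [lieD_frameZbar_pos, lieD_frameZ_linear]
    simp [linField_matU, linField_matV]
    linear_combination β ^ 2 * (pos q 0 : ℂ) * Complex.I_sq
  rw [e, lieD_frameZ_linear, lieD_frameZbar_pos]
  simp [linField_matU, linField_matV]
  linear_combination -2 * α * β ^ 2 * (pos p 2 : ℂ) * Complex.I_sq

theorem lieD_frameZbar_frameZbar_pos (p : S3) :
    lieD (frameZbar α β) (lieD (frameZbar α β) (fun q => (pos q 0 : ℂ))) p
      = (β ^ 2 - α ^ 2) * (pos p 0 : ℂ) := by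
  rw [lieD_frameZbar_pos, lieD_frameZbar_linear]
  simp [linField_matU, linField_matV]
  linear_combination -β ^ 2 * (pos p 0 : ℂ) * Complex.I_sq

/-- For the contact form `e^{2f} θ`, the Paneitz operator of the invariant structure multiplies the
coordinate `x₁` by `e^{-4f}` and by a constant, negative unless the structure is spherical. -/
theorem paneitz_confFrame_pos (h : 8 * α * β = 1) (hf : Smooth f) (p : S3) :
    (confFrame h hf).paneitz (fun q => (pos q 0 : ℂ)) p
      = -12 * (β ^ 2 - α ^ 2) ^ 2 * Complex.exp (-4 * (f p : ℂ)) * (pos p 0 : ℂ) := by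
  have hφ : Smooth (fun q : S3 => (pos q 0 : ℂ)) := (smooth_pos 0).ofReal
  have hψ : Smooth (lieD (frameZbar α β) (fun q => (pos q 0 : ℂ))) := smooth_frameZbar.lieD hφ
  have e : (confFrame h hf).P3 (fun q => (pos q 0 : ℂ)) = fun q => Complex.exp (-3 * (f q : ℂ))
      * ((-3 * (β ^ 2 - α ^ 2)) * lieD (frameZbar α β) (fun q => (pos q 0 : ℂ)) q) := by
    funext q
    rw [P3_confFrame h hf hφ, lieD_frameZ_frameZ_frameZbar_pos]
    ring
  have e4 : Complex.exp (-4 * (f p : ℂ))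
      = Complex.exp (-(f p : ℂ)) * Complex.exp (-3 * (f p : ℂ)) := by
    rw [← Complex.exp_add]
    ring_nf
  rw [UnitaryFrame.paneitz, covBar_confFrame, e, lieD_exp_mul _ hf ((smooth_const _).mul' hψ),
    lieD_const_mul _ hψ, lieD_frameZbar_frameZbar_pos, e4, ← confDbar]
  push_cast
  ring

end Paneitz

/-! ### The volume form and the sign of the quadratic form -/

section Volume

variable {f : S3 → ℝ}

theorem sum_perm_fin_four (G : Fin 4 → Fin 4 → Fin 4 → Fin 4 → ℝ) :
    ∑ σ : Equiv.Perm (Fin 4), ((Equiv.Perm.sign σ : ℤ) : ℝ) * G (σ 0) (σ 1) (σ 2) (σ 3)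
      = G 0 1 2 3 - G 0 1 3 2 - G 0 2 1 3 + G 0 2 3 1 + G 0 3 1 2 - G 0 3 2 1
        - G 1 0 2 3 + G 1 0 3 2 + G 1 2 0 3 - G 1 2 3 0 - G 1 3 0 2 + G 1 3 2 0
        + G 2 0 1 3 - G 2 0 3 1 - G 2 1 0 3 + G 2 1 3 0 + G 2 3 0 1 - G 2 3 1 0
        - G 3 0 1 2 + G 3 0 2 1 + G 3 1 0 2 - G 3 1 2 0 - G 3 2 0 1 + G 3 2 1 0 := by
  have e : (Finset.univ : Finset (Equiv.Perm (Fin 4))).val.map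
      (fun σ => ((Equiv.Perm.sign σ : ℤ), σ 0, σ 1, σ 2, σ 3))
      = (([(1, 0, 1, 2, 3), (-1, 0, 1, 3, 2), (-1, 0, 2, 1, 3), (1, 0, 2, 3, 1), (1, 0, 3, 1, 2),
        (-1, 0, 3, 2, 1), (-1, 1, 0, 2, 3), (1, 1, 0, 3, 2), (1, 1, 2, 0, 3), (-1, 1, 2, 3, 0),
        (-1, 1, 3, 0, 2), (1, 1, 3, 2, 0), (1, 2, 0, 1, 3), (-1, 2, 0, 3, 1), (-1, 2, 1, 0, 3),
        (1, 2, 1, 3, 0), (1, 2, 3, 0, 1), (-1, 2, 3, 1, 0), (-1, 3, 0, 1, 2), (1, 3, 0, 2, 1),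
        (1, 3, 1, 0, 2), (-1, 3, 1, 2, 0), (-1, 3, 2, 0, 1), (1, 3, 2, 1, 0)] : List (ℤ × Fin 4 × Fin 4 × Fin 4 × Fin 4)) : Multiset _) := by
    decide
  have h := congrArg (fun s : Multiset (ℤ × Fin 4 × Fin 4 × Fin 4 × Fin 4) =>
    (s.map fun t => (t.1 : ℝ) * G t.2.1 t.2.2.1 t.2.2.2.1 t.2.2.2.2).sum) e
  simp only [Multiset.map_map, Function.comp_def] at h
  refine h.trans ?_
  simp
  ring

theorem contactDensity_conformalContact (hf : Smooth f) (p : S3) :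
    contactDensity (conformalContact f) p = 8 * Real.exp (4 * f p) := by
  have hd (i j : Fin 4) : partialD (fun q => conformalContact f q j) i p
      = Real.exp (2 * f p) * (2 * partialD f i p * stdContact p j
        + partialD (fun q => stdContact q j) i p) := by
    have h1 : (fun q => conformalContact f q j)
        = fun q => Real.exp (2 * f q) * stdContact q j := rfl
    have h2 (i : Fin 4) : partialD (fun q => Real.exp (2 * f q)) i p
        = Real.exp (2 * f p) * (2 * partialD f i p) := by
      have h3 := partialD_comp (h := Real.exp) ((smooth_const (2 : ℝ)).mul' hf) p
        (Real.hasDerivAt_exp (2 * f p)).hasFDerivAt i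
      rw [partialD_mul (smooth_const 2) hf, partialD_const] at h3
      simp at h3
      rw [h3]
      ring
    rw [h1, partialD_mul (((smooth_const (2 : ℝ)).mul' hf).rexp) (smooth_pi.1 smooth_stdContact j),
      h2]
    ring
  have e4 : Real.exp (4 * f p) = Real.exp (2 * f p) ^ 2 := by
    rw [← Real.exp_nat_mul]
    ring_nf
  have hn := pos_norm p
  simp only [contactDensity, hd]
  rw [sum_perm_fin_four (fun a b c d => pos p a * conformalContact f p b * (Real.exp (2 * f p)
    * (2 * partialD f c p * stdContact p d + partialD (fun q => stdContact q d) c p))), e4]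
  simp only [conformalContact, Pi.smul_apply, smul_eq_mul, stdContact, Matrix.cons_val,
    partialD_coord]
  simp
  linear_combination 8 * Real.exp (2 * f p) ^ 2 * hn

/-- The quadratic form of the Paneitz operator is negative on the coordinate `x₁`. -/
theorem not_paneitzNonneg {α β : ℝ} (h : 8 * α * β = 1) (hne : α ^ 2 ≠ β ^ 2) (hf : Smooth f) :
    ¬ PaneitzNonneg (invariantCR α β h) (conformalContact f) := by
  intro hP
  have h1 := hP (confFrame h hf) (fun q => pos q 0) (smooth_pos 0)
  have e : (fun p => ((pos p 0 : ℝ) : ℂ) * (confFrame h hf).paneitz (fun q => (pos q 0 : ℂ)) p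
      * (contactDensity (conformalContact f) p : ℂ))
      = fun p => ((-96 * (β ^ 2 - α ^ 2) ^ 2 * pos p 0 ^ 2 : ℝ) : ℂ) := by
    funext p
    have he := exp_mul_exp_neg (4 * (f p : ℂ))
    rw [← neg_mul] at he
    rw [paneitz_confFrame_pos h hf, contactDensity_conformalContact hf]
    push_cast
    linear_combination -96 * (β ^ 2 - α ^ 2) ^ 2 * (pos p 0 : ℂ) ^ 2 * he
  rw [contactIntegral, e, integral_complex_ofReal, Complex.ofReal_re,
    MeasureTheory.integral_const_mul] at h1
  have hc : Continuous fun p : S3 => pos p 0 ^ 2 := (smooth_pos 0).continuous.pow 2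
  have hpos : 0 < ∫ p, pos p 0 ^ 2
      ∂((MeasureTheory.volume : MeasureTheory.Measure R4).toSphere) := by
    refine hc.integral_pos_of_hasCompactSupport_nonneg_nonzero
      (HasCompactSupport.of_compactSpace _) (fun p => sq_nonneg _)
      (x := ⟨EuclideanSpace.single 0 1, by simp⟩) ?_
    simp [pos]
  have hsq : 0 < (β ^ 2 - α ^ 2) ^ 2 := by
    have := sub_ne_zero.2 hne.symm
    positivity
  nlinarith [mul_pos hsq hpos]

end Volume

end CRSphere

theorem proposition4p1 :
    ∀ (k : ℕ) (ε : ℝ), 0 < ε → ∃ J : CRSphere.CRStructure,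
      CRSphere.CkClose k ε J CRSphere.stdCR ∧
      ∀ f : CRSphere.S3 → ℝ, CRSphere.Smooth f →
        ¬ CRSphere.PaneitzNonneg J (CRSphere.conformalContact f) := by
  intro k ε hε
  obtain ⟨α, β, h, hne, hclose⟩ := CRSphere.exists_ckClose k hε
  exact ⟨CRSphere.invariantCR α β h, hclose, fun _ hf => CRSphere.not_paneitzNonneg h hne hf⟩
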